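/- Let $T:[0,1]\to[0,1]$ be the doubling map, $Tx=2x$ for $x\le 1/2$ and $Tx=2x-1$ for $x>1/2$. A hole is an open interval $(a,b)$ with $0<a<b<1$; put $\mathcal J(a,b)=\{x\in[0,1] : T^nx\notin(a,b)\text{ for all }n\ge 0\}$. A hole $(a_0,b_0)$ is a first order critical hole (FOCH) if $\mathcal J(a,b)=\{0,1\}$ for every hole $(a,b)$ with $a<a_0$, $b>b_0$, and $\mathcal J(a,b)\ne\{0,1\}$ for every hole $(a,b)$ with $a>a_0$, $b<b_0$. A finite $0$-$1$ word is balanced if the numbers of $1$s in any two of its factors of equal length differ by at most $1$; it is cyclically balanced if $ww$ is balanced. For $r=p/q\in\mathbb Q\cap(0,1)$ in lowest terms, let $s=\omega_r^-$ (respectively $t=\omega_r^+$) be the lexicographically largest (respectively smallest) cyclically balanced word of length $q$ with exactly $p$ letters $1$ that begins with $0$ (respectively with $1$). Identify infinite $0$-$1$ words with the real numbers having that dyadic expansion, and let $\mathcal S=(1/4,1/2)\setminus\bigcup_{r\in\mathbb Q\cap(0,1)}[s^\infty,st^\infty]$. **Theorem.** A pair $(a_0,b_0)$ of real numbers is a FOCH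 for the doubling map if and only if it is one of the following: - $(a,1/2)$ or $(1/2,1-a)$ for some $a\in(0,1/4]$; - $(a,a+1/4)$ with $a\in\mathcal S$; - $(s^\infty,b)$ with $s=\omega_r^-$, $t=\omega_r^+$ for some $r\in\mathbb Q\cap(0,1)$ and $b\in[ts^\infty,t^\infty]$; - $(a,t^\infty)$ with $s=\omega_r^-$, $t=\omega_r^+$ for some $r\in\mathbb Q\cap(0,1)$ and $a\in(s^\infty,st^\infty]$. Consequently, the set of lengths $b_0-a_0$ of FOCHs $(a_0,b_0)$ is exactly $[1/4,1/2)$. -/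

import Mathlib

namespace DoublingHoles

noncomputable section

/-- The doubling map of `[0,1]`. -/
def doubling (x : ℝ) : ℝ := if x ≤ 1 / 2 then 2 * x else 2 * x - 1

/-- A hole is an open interval `(a, b)` with `0 < a < b < 1`, given by its endpoints. -/
def IsHole (a b : ℝ) : Prop := 0 < a ∧ a < b ∧ b < 1

/-- The points of `[0,1]` whose orbit under the doubling map never falls into `(a, b)`. -/
def survivors (a b : ℝ) : Set ℝ :=
  {x | x ∈ Set.Icc (0 : ℝ) 1 ∧ ∀ n : ℕ, doubling^[n] x ∉ Set.Ioo a b}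

/-- First order critical holes. -/
structure IsFOCH (a₀ b₀ : ℝ) : Prop where
  isHole : IsHole a₀ b₀
  larger : ∀ a b : ℝ, IsHole a b → a < a₀ → b₀ < b → survivors a b = {0, 1}
  smaller : ∀ a b : ℝ, IsHole a b → a₀ < a → b < b₀ → survivors a b ≠ {0, 1}

/-- Finite 0-1 words. The order `<` on them is the lexicographic one. -/
abbrev Word := List (Fin 2)

/-- Infinite 0-1 words, indexed from `0`. -/
abbrev InfWord := ℕ → Fin 2

/-- The real number in `[0,1]` with the given dyadic expansion. -/
def dyadic (x : InfWord) : ℝ := ∑' n : ℕ, ((x n : ℕ) : ℝ) / 2 ^ (n + 1)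

/-- The periodic infinite word `w^∞ = www…` (for a nonempty word `w`). -/
def wordRep (w : Word) : InfWord := fun n => w.getD (n % w.length) 0

/-- The concatenation `ux` of a finite word `u` and an infinite word `x`. -/
def wordAppend (u : Word) (x : InfWord) : InfWord :=
  fun n => if n < u.length then u.getD n 0 else x (n - u.length)

/-- A finite word is balanced if the numbers of 1s in any two of its factors of equal length
differ by at most one. -/
def IsBalanced (w : Word) : Prop :=
  ∀ u v : Word, u <:+: w → v <:+: w → u.length = v.length →
    |(u.count 1 : ℤ) - (v.count 1 : ℤ)| ≤ 1

/-- A finite word `w` is cyclically balanced if `w² = ww` is balanced. -/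
def IsCyclicallyBalanced (w : Word) : Prop := IsBalanced (w ++ w)

/-- The cyclically balanced words whose length is the denominator `q` of `r = p/q` (in lowest
terms), whose 1-ratio is `r`, and whose first letter is `c`. -/
def ratioWords (r : ℚ) (c : Fin 2) : Set Word :=
  {w | IsCyclicallyBalanced w ∧ w.length = r.den ∧
    (w.count 1 : ℚ) / (w.length : ℚ) = r ∧ w.head? = some c}

open Classical in
/-- `ω_r^-`: the lexicographically largest cyclically balanced word of length `q` with 1-ratio
`r = p/q` beginning with `0` (meaningful for `0 < r < 1`, where such a word exists). -/
def omegaMinus (r : ℚ) : Word :=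
  if h : ∃ w, IsGreatest (ratioWords r 0) w then h.choose else []

open Classical in
/-- `ω_r^+`: the lexicographically smallest cyclically balanced word of length `q` with 1-ratio
`r = p/q` beginning with `1` (meaningful for `0 < r < 1`, where such a word exists). -/
def omegaPlus (r : ℚ) : Word :=
  if h : ∃ w, IsLeast (ratioWords r 1) w then h.choose else []

/-- With `s = ω_r^-` and `t = ω_r^+`: the number with dyadic expansion `s^∞`. -/
def repS (r : ℚ) : ℝ := dyadic (wordRep (omegaMinus r))

/-- The number with dyadic expansion `t^∞`. -/
def repT (r : ℚ) : ℝ := dyadic (wordRep (omegaPlus r))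

/-- The number with dyadic expansion `st^∞`. -/
def appST (r : ℚ) : ℝ := dyadic (wordAppend (omegaMinus r) (wordRep (omegaPlus r)))

/-- The number with dyadic expansion `ts^∞`. -/
def appTS (r : ℚ) : ℝ := dyadic (wordAppend (omegaPlus r) (wordRep (omegaMinus r)))

/-- The exceptional set `𝒮`: the points of `(1/4, 1/2)` that lie in none of the intervals
`Δ(r) = [s^∞, st^∞]`, `r ∈ ℚ ∩ (0,1)`. -/
def exceptionalSet : Set ℝ :=
  Set.Ioo (1 / 4 : ℝ) (1 / 2) \
    ⋃ r ∈ Set.Ioo (0 : ℚ) 1, Set.Icc (repS r) (appST r)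

end

end DoublingHoles

/-!
The holes are governed by Sturmian words of rational slope. For `0 < r < 1`, the words `s^∞` and
`t^∞` have the letters `⌈n r⌉ - ⌈(n - 1) r⌉` and `⌊n r⌋ - ⌊(n - 1) r⌋`. Indeed, averaging over
cyclic factors shows that every cyclically balanced word of slope `r` has at most `⌈n r⌉` and at
least `⌊n r⌋` ones in each factor of length `n`, which gives extremality
(`isGreatest_prefixWord_ceilWord`, `isLeast_prefixWord_floorWord`). The words `s` and `t` differ
only in that they begin with `01` and `10`, so `ts^∞ = s^∞ + 1/4` and `st^∞ = t^∞ - 1/4` as real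
numbers (`appTS_eq`, `appST_eq`). By summation by parts (`dyadic_eq_tsum_ones`), dyadic values are
monotone in the numbers of ones in prefixes.

Two facts determine the survivors. The orbit of `s^∞` does not enter `(s^∞, t^∞)`
(`dyadic_ceilWord_mem_survivors`). On the other hand, suppose that an orbit other than `0` and `1`
avoids a hole reaching beyond `(s^∞, ts^∞)` on both sides. After each `0` of its itinerary the
first difference with `s^∞` leads to a later `0` after a block whose density of ones is less than
`r`, and after each `1` the first difference with `ts^∞` leads to a later `1` after a block whose
density is at least `r`. The gaps are bounded and `r` is rational, so the two chains force
incompatible growth of the number of ones (`not_both_letters`). The same argument applies to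
`(st^∞, t^∞)`.

The intervals `[s^∞, st^∞]` are dense in `(1/4, 1/2)` (`exists_slope`): the value of `s^∞` for the
slope `(k + 1) / N!` exceeds that of `st^∞` for the slope `k / N!` by at most the tail of a
convergent series. Together these facts show that every pair of the list is critical. Conversely,
two critical holes cannot be strictly nested (`IsFOCH.not_nested`), while every hole outside the
list is strictly nested with a hole of the list (`IsFOCH.isCritical`).
-/

namespace DoublingHoles

open Finset

/-! ### Dyadic expansions -/

/-- The number of `1`s among the letters `x 1, …, x n` of an infinite word; the initial letter
`x 0` is not counted. -/
def ones (x : InfWord) (n : ℕ) : ℤ := ∑ i ∈ range n, ((x (i + 1) : ℕ) : ℤ)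

/-- The infinite word with its first `k` letters removed. -/
def shift (k : ℕ) (x : InfWord) : InfWord := fun i => x (k + i)

lemma letter_eq (d : Fin 2) : d = 0 ∨ d = 1 := by
  fin_cases d <;> simp

lemma ones_add (x : InfWord) (k n : ℕ) : ones x (k + n) = ones x k + ones (shift k x) n := by
  simp only [ones, shift, sum_range_add, add_assoc]

lemma ones_succ (x : InfWord) (n : ℕ) : ones x (n + 1) = ones x n + ((x (n + 1) : ℕ) : ℤ) :=
  sum_range_succ _ _

lemma ones_nonneg (x : InfWord) (n : ℕ) : 0 ≤ ones x n :=
  sum_nonneg fun _ _ => Int.natCast_nonneg _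

lemma ones_le (x : InfWord) (n : ℕ) : ones x n ≤ n := by
  have h : ones x n ≤ ∑ i ∈ range n, (1 : ℤ) :=
    sum_le_sum fun i _ => by rcases letter_eq (x (i + 1)) with h | h <;> simp [h]
  simpa using h

lemma summable_dyadic (x : InfWord) : Summable fun n => ((x n : ℕ) : ℝ) / 2 ^ (n + 1) := by
  refine Summable.of_nonneg_of_le (fun n => by positivity) (fun n => ?_)
    (summable_geometric_two' 1)
  rw [pow_succ', ← div_div]
  gcongr
  rcases letter_eq (x n) with h | h <;> simp [h]

lemma dyadic_eq_sum_add (x : InfWord) (n : ℕ) :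
    dyadic x = ∑ i ∈ range n, ((x i : ℕ) : ℝ) / 2 ^ (i + 1) + dyadic (shift n x) / 2 ^ n := by
  rw [dyadic, ← (summable_dyadic x).sum_add_tsum_nat_add n, dyadic, ← tsum_div_const]
  congr 2
  ext i
  rw [shift, div_div, ← pow_add]
  congr 2
  · rw [add_comm i n]
  · ring

lemma dyadic_nonneg (x : InfWord) : 0 ≤ dyadic x :=
  tsum_nonneg fun n => by positivity

lemma dyadic_le_one (x : InfWord) : dyadic x ≤ 1 := by
  have h := tsum_geometric_two' (1 : ℝ)
  rw [dyadic, ← h]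
  refine (summable_dyadic x).tsum_le_tsum (fun n => ?_) (summable_geometric_two' 1)
  rw [pow_succ', ← div_div]
  gcongr
  rcases letter_eq (x n) with h | h <;> simp [h]

lemma dyadic_eq_head (x : InfWord) : dyadic x = ((x 0 : ℕ) : ℝ) / 2 + dyadic (shift 1 x) / 2 := by
  simpa using dyadic_eq_sum_add x 1

/-- A strict inequality between dyadic values is witnessed by the first letter at which the two
words differ, and a late first difference forces the values to be close. -/
lemma exists_first_diff {u v : InfWord} (h : dyadic u < dyadic v) :
    ∃ n, (∀ i < n, u i = v i) ∧ u n = 0 ∧ v n = 1 ∧ dyadic v - dyadic u ≤ 1 / 2 ^ n := by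
  classical
  have hne : ∃ n, u n ≠ v n := by
    by_contra! hc
    exact h.ne (congrArg dyadic (funext hc))
  have hn := Nat.find_spec hne
  have hlt : ∀ i < Nat.find hne, u i = v i := fun i hi => not_not.1 (Nat.find_min hne hi)
  set n := Nat.find hne
  have hsum : ∑ i ∈ range n, ((u i : ℕ) : ℝ) / 2 ^ (i + 1)
      = ∑ i ∈ range n, ((v i : ℕ) : ℝ) / 2 ^ (i + 1) :=
    sum_congr rfl fun i hi => by rw [hlt i (mem_range.1 hi)]
  have hu := dyadic_eq_sum_add u n
  have hv := dyadic_eq_sum_add v n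
  have hdiff : dyadic v - dyadic u = (dyadic (shift n v) - dyadic (shift n u)) / 2 ^ n := by
    rw [hu, hv, hsum]; ring
  refine ⟨n, hlt, ?_⟩
  have hp : (0 : ℝ) < 2 ^ n := by positivity
  have hclose : dyadic v - dyadic u ≤ 1 / 2 ^ n := by
    rw [hdiff]
    gcongr
    linarith [dyadic_le_one (shift n v), dyadic_nonneg (shift n u)]
  have hpos : 0 < dyadic (shift n v) - dyadic (shift n u) := by
    by_contra! hc
    have := div_nonpos_of_nonpos_of_nonneg hc hp.le
    linarith
  rcases letter_eq (u n) with h0 | h0 <;> rcases letter_eq (v n) with h1 | h1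
  · exact absurd (h0.trans h1.symm) hn
  · exact ⟨h0, h1, hclose⟩
  · have e1 := dyadic_eq_head (shift n v)
    have e2 := dyadic_eq_head (shift n u)
    have e3 : shift n v 0 = 0 := h1
    have e4 : shift n u 0 = 1 := h0
    rw [e3] at e1
    rw [e4] at e2
    have := dyadic_le_one (shift 1 (shift n v))
    have := dyadic_nonneg (shift 1 (shift n u))
    simp only [Fin.val_zero, Fin.val_one, Nat.cast_zero, Nat.cast_one] at e1 e2
    linarith
  · exact absurd (h0.trans h1.symm) hn

lemma summable_natCast_div_two_pow : Summable fun n : ℕ => ((n : ℝ) + 1) / 2 ^ (n + 2) := by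
  have h1 : Summable fun n : ℕ => (n : ℝ) ^ 1 * (1 / 2 : ℝ) ^ n :=
    summable_pow_mul_geometric_of_norm_lt_one 1 (by norm_num)
  have h := (h1.add summable_geometric_two).mul_left (1 / 4)
  refine h.congr fun n => ?_
  rw [pow_add, one_div_pow]
  field_simp
  ring

lemma summable_of_abs_le {f : ℕ → ℤ} (hf : ∀ n, |f n| ≤ n + 1) :
    Summable fun n => (f n : ℝ) / 2 ^ (n + 2) := by
  refine Summable.of_norm_bounded summable_natCast_div_two_pow fun n => ?_
  rw [norm_div, Real.norm_eq_abs, norm_pow, Real.norm_two]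
  gcongr
  exact_mod_cast hf n

lemma summable_ones (x : InfWord) : Summable fun n => (ones x n : ℝ) / 2 ^ (n + 2) :=
  summable_of_abs_le fun n => by
    rw [abs_of_nonneg (ones_nonneg x n)]; linarith [ones_le x n]

/-- Summation by parts: a dyadic value is a positive combination of the counts of `1`s in the
prefixes, which makes it monotone in these counts. -/
lemma dyadic_eq_tsum_ones (x : InfWord) :
    dyadic x = ((x 0 : ℕ) : ℝ) / 2 + ∑' n, (ones x n : ℝ) / 2 ^ (n + 2) := by
  have hs := summable_ones x
  have h0 := hs.tsum_eq_zero_add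
  have hd := (summable_dyadic x).tsum_eq_zero_add
  have hs1 : Summable fun n => ((x (n + 1) : ℕ) : ℝ) / 2 ^ (n + 1 + 1) :=
    (summable_nat_add_iff 1).2 (summable_dyadic x)
  have key : ∑' n, (ones x (n + 1) : ℝ) / 2 ^ (n + 1 + 2)
      = (∑' n, (ones x n : ℝ) / 2 ^ (n + 2)) / 2
        + (∑' n, ((x (n + 1) : ℕ) : ℝ) / 2 ^ (n + 1 + 1)) / 2 := by
    rw [← tsum_div_const, ← tsum_div_const, ← (hs.div_const 2).tsum_add (hs1.div_const 2)]
    refine tsum_congr fun n => ?_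
    rw [ones_succ]
    push_cast
    field_simp
    ring
  have hz : ones x 0 = 0 := by simp [ones]
  rw [hz] at h0
  rw [dyadic, hd]
  simp only [Int.cast_zero, zero_div, zero_add, pow_one] at h0 ⊢
  linarith

lemma dyadic_le_of_ones_le {x y : InfWord} (h0 : x 0 = y 0) (h : ∀ n, ones x n ≤ ones y n) :
    dyadic x ≤ dyadic y := by
  rw [dyadic_eq_tsum_ones x, dyadic_eq_tsum_ones y, h0]
  refine add_le_add le_rfl ((summable_ones x).tsum_le_tsum (fun n => ?_) (summable_ones y))
  gcongr
  exact_mod_cast h n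

/-! ### Orbits of the doubling map as words -/

lemma doubling_mem_Icc {x : ℝ} (hx : x ∈ Set.Icc (0 : ℝ) 1) : doubling x ∈ Set.Icc (0 : ℝ) 1 := by
  obtain ⟨h0, h1⟩ := hx
  unfold doubling
  split_ifs with h
  · constructor <;> linarith
  · constructor <;> linarith

lemma iterate_doubling_mem_Icc {x : ℝ} (hx : x ∈ Set.Icc (0 : ℝ) 1) (n : ℕ) :
    doubling^[n] x ∈ Set.Icc (0 : ℝ) 1 := by
  induction n with
  | zero => exact hx
  | succ n ih => rw [Function.iterate_succ_apply']; exact doubling_mem_Icc ih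

/-- The word recording on which branch of the doubling map the orbit of `x` lies; the point `1/2`
belongs to the branch of `0`. -/
noncomputable def itinerary (x : ℝ) : InfWord := fun n => if doubling^[n] x ≤ 1 / 2 then 0 else 1

lemma shift_itinerary (x : ℝ) (k : ℕ) : shift k (itinerary x) = itinerary (doubling^[k] x) := by
  funext i
  simp only [shift, itinerary, ← Function.iterate_add_apply, add_comm k i]

lemma dyadic_itinerary {x : ℝ} (hx : x ∈ Set.Icc (0 : ℝ) 1) : dyadic (itinerary x) = x := by
  have hpart : ∀ n, ∑ i ∈ range n, ((itinerary x i : ℕ) : ℝ) / 2 ^ (i + 1)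
      = x - doubling^[n] x * (1 / 2) ^ n := by
    intro n
    induction n with
    | zero => simp
    | succ n ih =>
      rw [sum_range_succ, ih, Function.iterate_succ_apply', itinerary, doubling]
      split_ifs with h
      · rw [one_div_pow, one_div_pow]
        simp only [Fin.val_zero, Nat.cast_zero]
        field_simp
        ring
      · rw [one_div_pow, one_div_pow]
        simp only [Fin.val_one, Nat.cast_one]
        field_simp
        ring
  have h1 := (summable_dyadic (itinerary x)).hasSum.tendsto_sum_nat
  have h2 : Filter.Tendsto (fun n => x - doubling^[n] x * (1 / 2) ^ n) Filter.atTop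
      (nhds (x - 0)) := by
    refine tendsto_const_nhds.sub ?_
    refine squeeze_zero (fun n => ?_) (fun n => ?_)
      (tendsto_pow_atTop_nhds_zero_of_lt_one (r := (1 / 2 : ℝ)) (by norm_num) (by norm_num))
    · exact mul_nonneg (iterate_doubling_mem_Icc hx n).1 (by positivity)
    · exact mul_le_of_le_one_left (by positivity) (iterate_doubling_mem_Icc hx n).2
  simp only [hpart] at h1
  rw [sub_zero] at h2
  exact tendsto_nhds_unique h1 h2

/-- The doubling map acts on dyadic values as the shift, provided that no shift of the word is
`1000…`, the expansion of `1/2` that the map does not follow. -/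
lemma iterate_doubling_dyadic {x : InfWord}
    (hx : ∀ k, x k = 1 → 1 / 2 < dyadic (shift k x)) (k : ℕ) :
    doubling^[k] (dyadic x) = dyadic (shift k x) := by
  induction k with
  | zero =>
    have h : shift 0 x = x := funext fun i => by simp [shift]
    rw [h, Function.iterate_zero_apply]
  | succ k ih =>
    have hs : shift 1 (shift k x) = shift (k + 1) x := by
      funext i; simp only [shift, add_assoc]
    have hh := dyadic_eq_head (shift k x)
    rw [hs] at hh
    have h0 : shift k x 0 = x k := rfl
    rw [h0] at hh
    rw [Function.iterate_succ_apply', ih, doubling]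
    rcases letter_eq (x k) with h | h
    · rw [h] at hh
      have := dyadic_le_one (shift (k + 1) x)
      simp only [Fin.val_zero, Nat.cast_zero] at hh
      rw [if_pos (by linarith)]
      linarith
    · have := hx k h
      rw [h] at hh
      simp only [Fin.val_one, Nat.cast_one] at hh
      rw [if_neg (by linarith)]
      linarith

/-! ### Holes that no orbit avoids -/

/-- A quantity that grows by at most `K` per unit step, and that does not grow along a chain of
positions with gaps at most `M`, is bounded above. -/
lemma le_of_chain {H : ℕ → ℤ} {K : ℤ} {M p₀ : ℕ} {Q : ℕ → Prop} (hK : 0 ≤ K)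
    (hstep : ∀ p, H (p + 1) ≤ H p + K) (h₀ : Q p₀)
    (hQ : ∀ p, Q p → ∃ n, 1 ≤ n ∧ n ≤ M ∧ Q (p + n) ∧ H (p + n) ≤ H p) (j : ℕ) :
    H (p₀ + j) ≤ H p₀ + K * M := by
  have hlin : ∀ p i : ℕ, H (p + i) ≤ H p + K * i := by
    intro p i
    induction i with
    | zero => simp
    | succ i ih =>
      have := hstep (p + i)
      rw [← add_assoc]
      push_cast
      linarith
  -- every position is within `M` after a position of the chain
  have hchain : ∀ j : ℕ, ∃ p i, Q p ∧ H p ≤ H p₀ ∧ p₀ + j = p + i ∧ i ≤ M := by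
    intro j
    induction j with
    | zero => exact ⟨p₀, 0, h₀, le_rfl, rfl, Nat.zero_le _⟩
    | succ j ih =>
      obtain ⟨p, i, hp, hHp, hji, hi⟩ := ih
      rcases Nat.lt_or_ge i M with hlt | hge
      · exact ⟨p, i + 1, hp, hHp, by omega, hlt⟩
      · obtain ⟨n, hn1, hnM, hq, hH⟩ := hQ p hp
        exact ⟨p + n, i + 1 - n, hq, hH.trans hHp, by omega, by omega⟩
  obtain ⟨p, i, -, hHp, hji, hi⟩ := hchain j
  have h1 := hlin p i
  rw [hji]
  have : K * i ≤ K * M := by gcongr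
  linarith

/-- The first letter at which a word starting with `0` drops below the word `u` yields a
block ending in `0` that contains one `1` less than the corresponding block of `u`. -/
lemma exists_step_zero {x u : InfWord} {M : ℕ} (hu : u 0 = 0)
    (hM : (1 : ℝ) / 2 ^ M < dyadic u - dyadic x) :
    ∃ n, n + 1 ≤ M ∧ x (n + 1) = 0 ∧ ones x (n + 1) = ones u (n + 1) - 1 := by
  have hpos : (0 : ℝ) < 1 / 2 ^ M := by positivity
  obtain ⟨n, hlt, hxn, hun, hc⟩ := exists_first_diff (u := x) (v := u) (by linarith)
  obtain _ | n := n
  · rw [hu] at hun; exact absurd hun (by decide)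
  refine ⟨n, ?_, hxn, ?_⟩
  · by_contra! hcon
    have : (1 : ℝ) / 2 ^ (n + 1) ≤ 1 / 2 ^ M := by
      gcongr
      · norm_num
    linarith
  · have : ones x n = ones u n :=
      sum_congr rfl fun i hi => by rw [hlt (i + 1) (by have := mem_range.1 hi; omega)]
    rw [ones_succ, ones_succ, hxn, hun, this]
    simp

lemma exists_step_one {x v : InfWord} {M : ℕ} (hv : v 0 = 1)
    (hM : (1 : ℝ) / 2 ^ M < dyadic x - dyadic v) :
    ∃ n, n + 1 ≤ M ∧ x (n + 1) = 1 ∧ ones x (n + 1) = ones v (n + 1) + 1 := by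
  have hpos : (0 : ℝ) < 1 / 2 ^ M := by positivity
  obtain ⟨n, hlt, hvn, hxn, hc⟩ := exists_first_diff (u := v) (v := x) (by linarith)
  obtain _ | n := n
  · rw [hv] at hvn; exact absurd hvn (by decide)
  refine ⟨n, ?_, hxn, ?_⟩
  · by_contra! hcon
    have : (1 : ℝ) / 2 ^ (n + 1) ≤ 1 / 2 ^ M := by
      gcongr
      · norm_num
    linarith
  · have : ones v n = ones x n :=
      sum_congr rfl fun i hi => by rw [hlt (i + 1) (by have := mem_range.1 hi; omega)]
    rw [ones_succ, ones_succ, hxn, hvn, this]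
    simp

/-- A word cannot contain both letters if from every `0` there is a bounded step to a later `0`
along which the density of `1`s is at most `p / q`, from every `1` there is a bounded step to a
later `1` along which it is at least `p / q`, and one of these inequalities is uniformly strict:
the two chains would force incompatible growth rates of the number of `1`s. -/
lemma not_both_letters {x : InfWord} {M : ℕ} {p q e₀ e₁ : ℤ} (he₀ : 0 ≤ e₀) (he₁ : 0 ≤ e₁)
    (he : 0 < e₀ + e₁)
    (h0 : ∀ k, x k = 0 → ∃ n, n + 1 ≤ M ∧ x (k + (n + 1)) = 0 ∧
      q * ones (shift k x) (n + 1) + e₀ ≤ p * (n + 1))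
    (h1 : ∀ k, x k = 1 → ∃ n, n + 1 ≤ M ∧ x (k + (n + 1)) = 1 ∧
      p * (n + 1) + e₁ ≤ q * ones (shift k x) (n + 1))
    {k₀ k₁ : ℕ} (hk₀ : x k₀ = 0) (hk₁ : x k₁ = 1) : False := by
  -- the excess `D` of the number of `1`s over the expected one, tilted by the strictness `e`
  set D : ℕ → ℤ := fun k => q * ones x k - p * k with hD
  have hDadd : ∀ k n, D (k + n) = D k + q * ones (shift k x) n - p * n := by
    intro k n
    simp only [hD, ones_add]
    push_cast
    ring
  have hD1 : ∀ k, |D (k + 1) - D k| ≤ |q| + |p| := by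
    intro k
    have h : D (k + 1) - D k = q * ones (shift k x) 1 - p := by rw [hDadd]; push_cast; ring
    have h2 : |ones (shift k x) 1| ≤ 1 := by
      rw [abs_of_nonneg (ones_nonneg _ _)]; exact_mod_cast ones_le (shift k x) 1
    rw [h]
    calc |q * ones (shift k x) 1 - p| ≤ |q * ones (shift k x) 1| + |p| := abs_sub _ _
      _ = |q| * |ones (shift k x) 1| + |p| := by rw [abs_mul]
      _ ≤ |q| * 1 + |p| := by gcongr
      _ = |q| + |p| := by ring
  have hMnn : (0 : ℤ) ≤ M := Int.natCast_nonneg _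
  have hK : ∀ e : ℤ, 0 ≤ e → 0 ≤ M * (|q| + |p|) + e := fun e he => by positivity
  have b0 := le_of_chain (H := fun k => M * D k + e₀ * k) (K := M * (|q| + |p|) + e₀) (M := M)
    (Q := fun k => x k = 0) (hK e₀ he₀) (fun k => by
      have := mul_le_mul_of_nonneg_left ((le_abs_self _).trans (hD1 k)) hMnn
      push_cast
      linarith) hk₀ (fun k hk => by
      obtain ⟨n, hnM, hxn, hn⟩ := h0 k hk
      refine ⟨n + 1, by omega, hnM, hxn, ?_⟩
      have hnM' : (n : ℤ) + 1 ≤ M := by exact_mod_cast hnM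
      have e1 := hDadd k (n + 1)
      push_cast at e1 ⊢
      have e2 : D (k + (n + 1)) ≤ D k - e₀ := by linarith
      have e3 := mul_le_mul_of_nonneg_left e2 hMnn
      have e4 := mul_le_mul_of_nonneg_left hnM' he₀
      linarith)
  have b1 := le_of_chain (H := fun k => -(M * D k) + e₁ * k) (K := M * (|q| + |p|) + e₁) (M := M)
    (Q := fun k => x k = 1) (hK e₁ he₁) (fun k => by
      have := mul_le_mul_of_nonneg_left ((neg_abs_le _).trans' (neg_le_neg (hD1 k))) hMnn
      push_cast
      linarith) hk₁ (fun k hk => by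
      obtain ⟨n, hnM, hxn, hn⟩ := h1 k hk
      refine ⟨n + 1, by omega, hnM, hxn, ?_⟩
      have hnM' : (n : ℤ) + 1 ≤ M := by exact_mod_cast hnM
      have e1 := hDadd k (n + 1)
      push_cast at e1 ⊢
      have e2 : D k + e₁ ≤ D (k + (n + 1)) := by linarith
      have e3 := mul_le_mul_of_nonneg_left e2 hMnn
      have e4 := mul_le_mul_of_nonneg_left hnM' he₁
      linarith)
  set B₀ : ℤ := M * D k₀ + e₀ * k₀ + (M * (|q| + |p|) + e₀) * M
  set B₁ : ℤ := -(M * D k₁) + e₁ * k₁ + (M * (|q| + |p|) + e₁) * M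
  set P : ℕ := k₀ + k₁ + (B₀ + B₁ + 1).toNat
  have c0 := b0 (k₁ + (B₀ + B₁ + 1).toNat)
  have c1 := b1 (k₀ + (B₀ + B₁ + 1).toNat)
  have r0 : k₀ + (k₁ + (B₀ + B₁ + 1).toNat) = P := by omega
  have r1 : k₁ + (k₀ + (B₀ + B₁ + 1).toNat) = P := by omega
  rw [r0] at c0
  rw [r1] at c1
  have hP : B₀ + B₁ + 1 ≤ P := by
    have := Int.self_le_toNat (B₀ + B₁ + 1)
    have h2 : (B₀ + B₁ + 1).toNat ≤ P := by omega
    exact this.trans (by exact_mod_cast h2)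
  have hsum : (e₀ + e₁) * P ≤ B₀ + B₁ := by
    have : (e₀ + e₁) * P = (M * D P + e₀ * P) + (-(M * D P) + e₁ * P) := by ring
    rw [this]
    exact add_le_add c0 c1
  have : (1 : ℤ) * P ≤ (e₀ + e₁) * P := by
    gcongr
    omega
  linarith

lemma zero_mem_survivors {a b : ℝ} (h : IsHole a b) : (0 : ℝ) ∈ survivors a b := by
  have h0 : doubling 0 = 0 := by norm_num [doubling]
  refine ⟨by norm_num, fun n hn => ?_⟩
  rw [Function.iterate_fixed h0] at hn
  exact absurd hn.1 (not_lt.2 h.1.le)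

lemma one_mem_survivors {a b : ℝ} (h : IsHole a b) : (1 : ℝ) ∈ survivors a b := by
  have h1 : doubling 1 = 1 := by norm_num [doubling]
  refine ⟨by norm_num, fun n hn => ?_⟩
  rw [Function.iterate_fixed h1] at hn
  exact absurd hn.2 (not_lt.2 h.2.2.le)

lemma half_mem_survivors {a b : ℝ} (hb : b < 1) (h : 1 / 2 ∉ Set.Ioo a b) :
    (1 / 2 : ℝ) ∈ survivors a b := by
  have h1 : doubling 1 = 1 := by norm_num [doubling]
  have h2 : doubling (1 / 2) = 1 := by norm_num [doubling]
  refine ⟨by norm_num, fun n hn => ?_⟩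
  cases n with
  | zero => exact h hn
  | succ n =>
    rw [Function.iterate_succ_apply, h2, Function.iterate_fixed h1] at hn
    exact absurd hn.2 (not_lt.2 hb.le)

lemma survivors_ne {a b x : ℝ} (hx : x ∈ survivors a b) (h0 : x ≠ 0) (h1 : x ≠ 1) :
    survivors a b ≠ {0, 1} := by
  intro h
  rw [h] at hx
  rcases hx with hx | hx
  · exact h0 hx
  · exact h1 hx

/-- If the prefixes of `u` and `v` are tuned to the density `p / q`, then every orbit other than
the two fixed points enters any hole that reaches strictly below `u` and strictly above `v`:
the itinerary of an orbit avoiding it would be smaller than `u` from each `0` on and larger than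
`v` from each `1` on. -/
lemma survivors_eq_of_words {u v : InfWord} {p q e₀ e₁ : ℤ} (he₀ : 0 ≤ e₀) (he₁ : 0 ≤ e₁)
    (he : 0 < e₀ + e₁) (hu0 : u 0 = 0) (hv0 : v 0 = 1)
    (hu : ∀ n : ℕ, q * (ones u (n + 1) - 1) + e₀ ≤ p * (n + 1))
    (hv : ∀ n : ℕ, p * (n + 1) + e₁ ≤ q * (ones v (n + 1) + 1))
    {a b : ℝ} (hab : IsHole a b) (ha : a < dyadic u) (hb : dyadic v < b) :
    survivors a b = {0, 1} := by
  have ha2 : a < 1 / 2 := by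
    have h := dyadic_eq_head u
    have := dyadic_le_one (shift 1 u)
    rw [hu0] at h
    simp only [Fin.val_zero, Nat.cast_zero] at h
    linarith
  have hb2 : 1 / 2 < b := by
    have h := dyadic_eq_head v
    have := dyadic_nonneg (shift 1 v)
    rw [hv0] at h
    simp only [Fin.val_one, Nat.cast_one] at h
    linarith
  refine Set.Subset.antisymm (fun x hx => ?_) ?_
  · obtain ⟨hx, hav⟩ := hx
    by_contra hne
    rw [Set.mem_insert_iff, Set.mem_singleton_iff, not_or] at hne
    obtain ⟨M, hM⟩ := exists_pow_lt_of_lt_one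
      (show 0 < min (dyadic u - a) (b - dyadic v) from lt_min (by linarith) (by linarith))
      (show (1 / 2 : ℝ) < 1 by norm_num)
    rw [one_div_pow, lt_min_iff] at hM
    have hdy : ∀ k, dyadic (shift k (itinerary x)) = doubling^[k] x := fun k => by
      rw [shift_itinerary, dyadic_itinerary (iterate_doubling_mem_Icc hx k)]
    have hex0 : ∃ k, itinerary x k = 0 := by
      by_contra! hc
      have h : itinerary x = itinerary 1 := by
        have h1 : doubling 1 = 1 := by norm_num [doubling]
        funext k
        rcases letter_eq (itinerary x k) with h | h
        · exact absurd h (hc k)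
        · rw [h, itinerary, Function.iterate_fixed h1, if_neg (by norm_num)]
      apply hne.2
      rw [← dyadic_itinerary hx, h, dyadic_itinerary (by norm_num)]
    have hex1 : ∃ k, itinerary x k = 1 := by
      by_contra! hc
      have h : itinerary x = itinerary 0 := by
        have h1 : doubling 0 = 0 := by norm_num [doubling]
        funext k
        rcases letter_eq (itinerary x k) with h | h
        · rw [h, itinerary, Function.iterate_fixed h1, if_pos (by norm_num)]
        · exact absurd h (hc k)
      apply hne.1
      rw [← dyadic_itinerary hx, h, dyadic_itinerary (by norm_num)]
    obtain ⟨k₀, hk₀⟩ := hex0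
    obtain ⟨k₁, hk₁⟩ := hex1
    refine not_both_letters (x := itinerary x) (M := M) (p := p) (q := q) he₀ he₁ he
      (fun k hk => ?_) (fun k hk => ?_) hk₀ hk₁
    · have hle : doubling^[k] x ≤ 1 / 2 := by
        by_contra hc
        rw [itinerary, if_neg hc] at hk
        exact absurd hk (by decide)
      have hle' : doubling^[k] x ≤ a := by
        by_contra! hc
        exact hav k ⟨hc, hle.trans_lt hb2⟩
      obtain ⟨n, hnM, hxn, hones⟩ := exists_step_zero (x := shift k (itinerary x)) (M := M)
        hu0 (by rw [hdy]; linarith [hM.1])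
      exact ⟨n, hnM, hxn, by rw [hones]; exact hu n⟩
    · have hgt : 1 / 2 < doubling^[k] x := by
        by_contra! hc
        rw [itinerary, if_pos hc] at hk
        exact absurd hk (by decide)
      have hge : b ≤ doubling^[k] x := by
        by_contra! hc
        exact hav k ⟨ha2.trans hgt, hc⟩
      obtain ⟨n, hnM, hxn, hones⟩ := exists_step_one (x := shift k (itinerary x)) (M := M)
        hv0 (by rw [hdy]; linarith [hM.2])
      exact ⟨n, hnM, hxn, by rw [hones]; exact hv n⟩
  · rintro x (rfl | rfl)
    · exact zero_mem_survivors hab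
    · exact one_mem_survivors hab

/-! ### Sturmian words of rational slope -/

/-- The word whose letter at `n` is the increment `f n - f (n - 1)`, for a sequence `f` with
increments in `{0, 1}`. -/
def incrementWord (f : ℤ → ℤ) : InfWord := fun n => if f n = f (n - 1) then 0 else 1

/-- The word with letters `⌈n r⌉ - ⌈(n - 1) r⌉`; for rational `0 < r < 1` it is `s^∞`. -/
def ceilWord (r : ℚ) : InfWord := incrementWord fun z => ⌈(z : ℚ) * r⌉

/-- The word with letters `⌊n r⌋ - ⌊(n - 1) r⌋`; for rational `0 < r < 1` it is `t^∞`. -/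
def floorWord (r : ℚ) : InfWord := incrementWord fun z => ⌊(z : ℚ) * r⌋

/-- The word with its first two letters exchanged. -/
def exchange (x : InfWord) : InfWord := fun n => if n = 0 then x 1 else if n = 1 then x 0 else x n

lemma incrementWord_val {f : ℤ → ℤ} {n : ℕ}
    (hf : f n = f (n - 1) ∨ f n = f (n - 1) + 1) :
    ((incrementWord f n : ℕ) : ℤ) = f n - f (n - 1) := by
  unfold incrementWord
  rcases hf with h | h <;> simp [h]

lemma ones_incrementWord {f : ℤ → ℤ} (hf : ∀ z, f z = f (z - 1) ∨ f z = f (z - 1) + 1) (n : ℕ) :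
    ones (incrementWord f) n = f n - f 0 := by
  induction n with
  | zero => simp [ones]
  | succ n ih =>
    rw [ones_succ, ih, incrementWord_val (hf _)]
    push_cast
    rw [add_sub_cancel_right]
    ring

lemma ceil_increment {r : ℚ} (h0 : 0 < r) (h1 : r < 1) (z : ℤ) :
    ⌈(z : ℚ) * r⌉ = ⌈((z - 1 : ℤ) : ℚ) * r⌉ ∨ ⌈(z : ℚ) * r⌉ = ⌈((z - 1 : ℤ) : ℚ) * r⌉ + 1 := by
  have e : ((z - 1 : ℤ) : ℚ) * r = z * r - r := by push_cast; ring
  have l : ⌈((z - 1 : ℤ) : ℚ) * r⌉ ≤ ⌈(z : ℚ) * r⌉ := by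
    rw [e]; exact Int.ceil_mono (by linarith)
  have u : ⌈(z : ℚ) * r⌉ ≤ ⌈((z - 1 : ℤ) : ℚ) * r⌉ + 1 := by
    rw [e, ← Int.ceil_add_one]; exact Int.ceil_mono (by linarith)
  omega

lemma floor_increment {r : ℚ} (h0 : 0 < r) (h1 : r < 1) (z : ℤ) :
    ⌊(z : ℚ) * r⌋ = ⌊((z - 1 : ℤ) : ℚ) * r⌋ ∨ ⌊(z : ℚ) * r⌋ = ⌊((z - 1 : ℤ) : ℚ) * r⌋ + 1 := by
  have e : ((z - 1 : ℤ) : ℚ) * r = z * r - r := by push_cast; ring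
  have l : ⌊((z - 1 : ℤ) : ℚ) * r⌋ ≤ ⌊(z : ℚ) * r⌋ := by
    rw [e]; exact Int.floor_mono (by linarith)
  have u : ⌊(z : ℚ) * r⌋ ≤ ⌊((z - 1 : ℤ) : ℚ) * r⌋ + 1 := by
    rw [e, ← Int.floor_add_one]; exact Int.floor_mono (by linarith)
  omega

lemma ceilWord_val {r : ℚ} (h0 : 0 < r) (h1 : r < 1) (n : ℕ) :
    ((ceilWord r n : ℕ) : ℤ) = ⌈(n : ℚ) * r⌉ - ⌈((n : ℚ) - 1) * r⌉ := by
  rw [ceilWord, incrementWord_val (ceil_increment h0 h1 _)]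
  push_cast
  rfl

lemma floorWord_val {r : ℚ} (h0 : 0 < r) (h1 : r < 1) (n : ℕ) :
    ((floorWord r n : ℕ) : ℤ) = ⌊(n : ℚ) * r⌋ - ⌊((n : ℚ) - 1) * r⌋ := by
  rw [floorWord, incrementWord_val (floor_increment h0 h1 _)]
  push_cast
  rfl

lemma ones_ceilWord {r : ℚ} (h0 : 0 < r) (h1 : r < 1) (n : ℕ) :
    ones (ceilWord r) n = ⌈(n : ℚ) * r⌉ := by
  rw [ceilWord, ones_incrementWord (ceil_increment h0 h1)]
  simp

lemma ones_floorWord {r : ℚ} (h0 : 0 < r) (h1 : r < 1) (n : ℕ) :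
    ones (floorWord r) n = ⌊(n : ℚ) * r⌋ := by
  rw [floorWord, ones_incrementWord (floor_increment h0 h1)]
  simp

lemma ceilWord_zero {r : ℚ} (h0 : 0 < r) (h1 : r < 1) : ceilWord r 0 = 0 := by
  have h : ⌈-r⌉ = 0 := Int.ceil_eq_zero_iff.2 ⟨by linarith, by linarith⟩
  simp [ceilWord, incrementWord, h]

lemma ceilWord_one {r : ℚ} (h0 : 0 < r) (h1 : r < 1) : ceilWord r 1 = 1 := by
  have h : ⌈r⌉ = 1 := Int.ceil_eq_iff.2 ⟨by norm_num; exact h0, by norm_num; exact h1.le⟩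
  simp [ceilWord, incrementWord, h]

lemma floorWord_zero {r : ℚ} (h0 : 0 < r) (h1 : r < 1) : floorWord r 0 = 1 := by
  have h : ⌊-r⌋ = -1 := Int.floor_eq_iff.2 ⟨by norm_num; exact h1.le, by norm_num; exact h0⟩
  simp [floorWord, incrementWord, h]

lemma floorWord_one {r : ℚ} (h0 : 0 < r) (h1 : r < 1) : floorWord r 1 = 0 := by
  have h : ⌊r⌋ = 0 := Int.floor_eq_zero_iff.2 ⟨h0.le, h1⟩
  simp [floorWord, incrementWord, h]

lemma incrementWord_add_period {f : ℤ → ℤ} {q : ℕ} {p : ℤ} (h : ∀ z, f (z + q) = f z + p)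
    (n : ℕ) : incrementWord f (n + q) = incrementWord f n := by
  have e : ((n + q : ℕ) : ℤ) - 1 = (n - 1 : ℤ) + q := by push_cast; ring
  unfold incrementWord
  rw [e, Nat.cast_add, h, h]
  simp only [add_left_inj]

lemma ceilWord_add_den (r : ℚ) (n : ℕ) : ceilWord r (n + r.den) = ceilWord r n := by
  refine incrementWord_add_period (p := r.num) (fun z => ?_) n
  rw [← Int.ceil_add_intCast, ← Rat.mul_den_eq_num]
  congr 1
  push_cast
  ring

lemma floorWord_add_den (r : ℚ) (n : ℕ) : floorWord r (n + r.den) = floorWord r n := by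
  refine incrementWord_add_period (p := r.num) (fun z => ?_) n
  rw [← Int.floor_add_intCast, ← Rat.mul_den_eq_num]
  congr 1
  push_cast
  ring

lemma ones_exchange (x : InfWord) (n : ℕ) :
    ones (exchange x) (n + 1) = ones x (n + 1) + (x 0 : ℕ) - (x 1 : ℕ) := by
  induction n with
  | zero => simp [ones, exchange]
  | succ n ih =>
    rw [ones_succ, ih, ones_succ x (n + 1)]
    simp only [exchange, Nat.add_eq_zero_iff, one_ne_zero, and_false, if_false, Nat.add_eq_right]
    ring

lemma dyadic_exchange (x : InfWord) :
    dyadic (exchange x) = dyadic x + (((x 1 : ℕ) : ℝ) - (x 0 : ℕ)) / 4 := by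
  have h : shift 2 (exchange x) = shift 2 x := by
    funext i
    simp only [shift, exchange]
    rw [if_neg (by omega), if_neg (by omega)]
  rw [dyadic_eq_sum_add (exchange x) 2, dyadic_eq_sum_add x 2, h]
  simp only [sum_range_succ, range_zero, sum_empty, exchange]
  norm_num
  ring

lemma dyadic_exchange_ceilWord {r : ℚ} (h0 : 0 < r) (h1 : r < 1) :
    dyadic (exchange (ceilWord r)) = dyadic (ceilWord r) + 1 / 4 := by
  rw [dyadic_exchange, ceilWord_zero h0 h1, ceilWord_one h0 h1]
  norm_num

lemma dyadic_exchange_floorWord {r : ℚ} (h0 : 0 < r) (h1 : r < 1) :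
    dyadic (exchange (floorWord r)) = dyadic (floorWord r) - 1 / 4 := by
  rw [dyadic_exchange, floorWord_zero h0 h1, floorWord_one h0 h1]
  norm_num
  ring

lemma dyadic_ceilWord_add_le {r : ℚ} (h0 : 0 < r) (h1 : r < 1) :
    dyadic (ceilWord r) + 1 / 4 ≤ dyadic (floorWord r) := by
  have h : dyadic (ceilWord r) ≤ dyadic (exchange (floorWord r)) := by
    refine dyadic_le_of_ones_le ?_ fun n => ?_
    · rw [ceilWord_zero h0 h1, exchange, if_pos rfl, floorWord_one h0 h1]
    · cases n with
      | zero => simp [ones]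
      | succ n =>
        rw [ones_exchange, ones_ceilWord h0 h1, ones_floorWord h0 h1, floorWord_zero h0 h1,
          floorWord_one h0 h1]
        simpa using Int.ceil_le_floor_add_one (((n + 1 : ℕ) : ℚ) * r)
  rw [dyadic_exchange_floorWord h0 h1] at h
  linarith

lemma dyadic_pos {x : InfWord} {n : ℕ} (hn : x n = 1) : 0 < dyadic x :=
  (summable_dyadic x).tsum_pos (fun i => by positivity) n (by simp [hn])

lemma dyadic_lt_one {x : InfWord} {n : ℕ} (hn : x n = 0) : dyadic x < 1 := by
  rw [dyadic, ← tsum_geometric_two' (1 : ℝ)]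
  refine (summable_dyadic x).tsum_lt_tsum (i := n) (fun i => ?_) ?_ (summable_geometric_two' 1)
  · rw [pow_succ', ← div_div]
    gcongr
    rcases letter_eq (x i) with h | h <;> simp [h]
  · rw [hn]
    simp

lemma quarter_lt_dyadic_ceilWord {r : ℚ} (h0 : 0 < r) (h1 : r < 1) :
    1 / 4 < dyadic (ceilWord r) := by
  have hd := r.den_pos
  have h : 0 < dyadic (shift 2 (ceilWord r)) := by
    refine dyadic_pos (n := r.den - 1) ?_
    rw [shift, show 2 + (r.den - 1) = 1 + r.den by omega, ceilWord_add_den, ceilWord_one h0 h1]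
  rw [dyadic_eq_sum_add _ 2]
  simp only [sum_range_succ, range_zero, sum_empty, ceilWord_zero h0 h1, zero_add,
    ceilWord_one h0 h1]
  norm_num
  exact h

lemma dyadic_floorWord_lt {r : ℚ} (h0 : 0 < r) (h1 : r < 1) :
    dyadic (floorWord r) < 3 / 4 := by
  have hd := r.den_pos
  have h : dyadic (shift 2 (floorWord r)) < 1 := by
    refine dyadic_lt_one (n := r.den - 1) ?_
    rw [shift, show 2 + (r.den - 1) = 1 + r.den by omega, floorWord_add_den, floorWord_one h0 h1]
  rw [dyadic_eq_sum_add _ 2]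
  simp only [sum_range_succ, range_zero, sum_empty, floorWord_zero h0 h1, zero_add,
    floorWord_one h0 h1]
  norm_num
  linarith

/-! ### Holes attached to a rational slope -/

/-- The orbit of `s^∞` never enters `(s^∞, t^∞)`. -/
lemma dyadic_ceilWord_mem_survivors {r : ℚ} (h0 : 0 < r) (h1 : r < 1) {a b : ℝ}
    (ha : dyadic (ceilWord r) ≤ a) (hb : b ≤ dyadic (floorWord r)) :
    dyadic (ceilWord r) ∈ survivors a b := by
  have hones : ∀ k n, ones (shift k (ceilWord r)) n = ⌈((k : ℚ) + n) * r⌉ - ⌈(k : ℚ) * r⌉ := by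
    intro k n
    have := ones_add (ceilWord r) k n
    rw [ones_ceilWord h0 h1, ones_ceilWord h0 h1] at this
    push_cast at this
    linarith
  have hzero : ∀ k, ceilWord r k = 0 → dyadic (shift k (ceilWord r)) ≤ dyadic (ceilWord r) := by
    intro k hk
    refine dyadic_le_of_ones_le ?_ fun n => ?_
    · rw [ceilWord_zero h0 h1]; exact hk
    · rw [hones, ones_ceilWord h0 h1, add_mul]
      have := Int.ceil_add_le ((k : ℚ) * r) (n * r)
      linarith
  have hone : ∀ k, ceilWord r k = 1 → dyadic (floorWord r) ≤ dyadic (shift k (ceilWord r)) := by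
    intro k hk
    refine dyadic_le_of_ones_le ?_ fun n => ?_
    · rw [floorWord_zero h0 h1]; exact hk.symm
    · rw [hones, ones_floorWord h0 h1, add_mul]
      have : ⌈(k : ℚ) * r⌉ + ⌊(n : ℚ) * r⌋ ≤ ⌈(k : ℚ) * r + n * r⌉ := by
        rw [← Int.ceil_add_intCast]
        exact Int.ceil_mono (by linarith [Int.floor_le ((n : ℚ) * r)])
      linarith
  have hhalf : 1 / 2 < dyadic (floorWord r) := by
    linarith [quarter_lt_dyadic_ceilWord h0 h1, dyadic_ceilWord_add_le h0 h1]
  refine ⟨⟨dyadic_nonneg _, dyadic_le_one _⟩, fun k hk => ?_⟩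
  rw [iterate_doubling_dyadic fun k hk => hhalf.trans_le (hone k hk)] at hk
  rcases letter_eq (ceilWord r k) with h | h
  · linarith [hzero k h, hk.1]
  · linarith [hone k h, hk.2]

lemma survivors_ne_of_slope {r : ℚ} (h0 : 0 < r) (h1 : r < 1) {a b : ℝ}
    (ha : dyadic (ceilWord r) ≤ a) (hb : b ≤ dyadic (floorWord r)) :
    survivors a b ≠ {0, 1} := by
  have := quarter_lt_dyadic_ceilWord h0 h1
  have := dyadic_ceilWord_add_le h0 h1
  have := dyadic_floorWord_lt h0 h1
  exact survivors_ne (dyadic_ceilWord_mem_survivors h0 h1 ha hb) (by linarith) (by linarith)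

/-- Only the fixed points avoid a hole reaching beyond `(s^∞, ts^∞)` on both sides. -/
lemma survivors_eq_of_lt_ceilWord {r : ℚ} (h0 : 0 < r) (h1 : r < 1) {a b : ℝ}
    (hab : IsHole a b) (ha : a < dyadic (ceilWord r)) (hb : dyadic (ceilWord r) + 1 / 4 < b) :
    survivors a b = {0, 1} := by
  have hden : (0 : ℚ) < r.den := by exact_mod_cast r.den_pos
  have hz : ∀ n : ℕ, ((r.num : ℚ)) * (n + 1) = r.den * (((n + 1 : ℕ) : ℚ) * r) := fun n => by
    rw [← Rat.mul_den_eq_num]; push_cast; ring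
  refine survivors_eq_of_words (u := ceilWord r) (v := exchange (ceilWord r)) (p := r.num)
    (q := r.den) (e₀ := 1) (e₁ := 0) (by norm_num) le_rfl (by norm_num) (ceilWord_zero h0 h1)
    ?_ (fun n => ?_) (fun n => ?_) hab ha (by rwa [dyadic_exchange_ceilWord h0 h1])
  · rw [exchange, if_pos rfl, ceilWord_one h0 h1]
  · rw [ones_ceilWord h0 h1, Int.add_one_le_iff]
    have h : (r.den : ℚ) * (⌈((n + 1 : ℕ) : ℚ) * r⌉ - 1) < r.num * (n + 1) := by
      rw [hz]
      gcongr
      linarith [Int.ceil_lt_add_one (((n + 1 : ℕ) : ℚ) * r)]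
    exact_mod_cast h
  · rw [ones_exchange, ones_ceilWord h0 h1, ceilWord_zero h0 h1, ceilWord_one h0 h1]
    have h : (r.num : ℚ) * (n + 1) ≤ r.den * ⌈((n + 1 : ℕ) : ℚ) * r⌉ := by
      rw [hz]
      gcongr
      exact Int.le_ceil _
    have h' : r.num * (n + 1) ≤ r.den * ⌈((n + 1 : ℕ) : ℚ) * r⌉ := by exact_mod_cast h
    simpa using h'

/-- Only the fixed points avoid a hole reaching beyond `(st^∞, t^∞)` on both sides. -/
lemma survivors_eq_of_floorWord_lt {r : ℚ} (h0 : 0 < r) (h1 : r < 1) {a b : ℝ}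
    (hab : IsHole a b) (ha : a < dyadic (floorWord r) - 1 / 4) (hb : dyadic (floorWord r) < b) :
    survivors a b = {0, 1} := by
  have hden : (0 : ℚ) < r.den := by exact_mod_cast r.den_pos
  have hz : ∀ n : ℕ, ((r.num : ℚ)) * (n + 1) = r.den * (((n + 1 : ℕ) : ℚ) * r) := fun n => by
    rw [← Rat.mul_den_eq_num]; push_cast; ring
  refine survivors_eq_of_words (u := exchange (floorWord r)) (v := floorWord r) (p := r.num)
    (q := r.den) (e₀ := 0) (e₁ := 1) le_rfl (by norm_num) (by norm_num) ?_
    (floorWord_zero h0 h1) (fun n => ?_) (fun n => ?_) hab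
    (by rwa [dyadic_exchange_floorWord h0 h1]) hb
  · rw [exchange, if_pos rfl, floorWord_one h0 h1]
  · rw [ones_exchange, ones_floorWord h0 h1, floorWord_zero h0 h1, floorWord_one h0 h1]
    have h : (r.den : ℚ) * ⌊((n + 1 : ℕ) : ℚ) * r⌋ ≤ r.num * (n + 1) := by
      rw [hz]
      gcongr
      exact Int.floor_le _
    have h' : r.den * ⌊((n + 1 : ℕ) : ℚ) * r⌋ ≤ r.num * (n + 1) := by exact_mod_cast h
    simpa using h'
  · rw [ones_floorWord h0 h1, Int.add_one_le_iff]
    have h : (r.num : ℚ) * (n + 1) < r.den * (⌊((n + 1 : ℕ) : ℚ) * r⌋ + 1) := by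
      rw [hz]
      gcongr
      exact Int.lt_floor_add_one _
    exact_mod_cast h

/-! ### Density of the intervals `[s^∞, st^∞]` -/

lemma tsum_one_div_two_pow : ∑' n : ℕ, (1 : ℝ) / 2 ^ (n + 2) = 1 / 2 := by
  have h := (tsum_geometric_two' (1 / 2 : ℝ))
  rw [← h]
  refine tsum_congr fun n => ?_
  rw [pow_add]
  field_simp

lemma tsum_natCast_div_two_pow : ∑' n : ℕ, (n : ℝ) / 2 ^ (n + 2) = 1 / 2 := by
  have h := tsum_coe_mul_geometric_of_norm_lt_one (𝕜 := ℝ) (r := 1 / 2) (by norm_num)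
  have h2 : ∑' n : ℕ, (n : ℝ) / 2 ^ (n + 2) = ∑' n : ℕ, (n * (1 / 2 : ℝ) ^ n) / 4 := by
    refine tsum_congr fun n => ?_
    rw [pow_add, one_div_pow]
    field_simp
    norm_num
  rw [h2, tsum_div_const, h]
  norm_num

lemma abs_ceil_le {r : ℚ} (h0 : 0 ≤ r) (h1 : r ≤ 1) (n : ℕ) : |⌈(n : ℚ) * r⌉| ≤ n + 1 := by
  have hl : 0 ≤ ⌈(n : ℚ) * r⌉ := Int.ceil_nonneg (by positivity)
  have hu : ⌈(n : ℚ) * r⌉ ≤ n :=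
    Int.ceil_le.2 (by simpa using mul_le_of_le_one_right (Nat.cast_nonneg n) h1)
  rw [abs_of_nonneg hl]
  omega

lemma abs_floor_le {r : ℚ} (h0 : 0 ≤ r) (h1 : r ≤ 1) (n : ℕ) : |⌊(n : ℚ) * r⌋| ≤ n + 1 := by
  have hl : 0 ≤ ⌊(n : ℚ) * r⌋ := Int.floor_nonneg.2 (by positivity)
  have hu := Int.floor_le_ceil ((n : ℚ) * r)
  have := (le_abs_self _).trans (abs_ceil_le h0 h1 n)
  rw [abs_of_nonneg hl]
  omega

/-- No multiple of `1 / n` lies strictly between two consecutive multiples of `1 / M` when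
`n` divides `M`. -/
lemma ceil_le_floor_add_one_of_dvd {n M : ℕ} (hM : 0 < M) (hn : n ∣ M) (k : ℕ) :
    ⌈(n : ℚ) * ((k + 1 : ℕ) / M)⌉ ≤ ⌊(n : ℚ) * (k / M)⌋ + 1 := by
  obtain ⟨d, rfl⟩ := hn
  have hn0 : (n : ℚ) ≠ 0 := by rintro h; simp_all
  have hd0 : 0 < d := Nat.pos_of_mul_pos_left hM
  have e : ∀ j : ℕ, (n : ℚ) * (j / (n * d : ℕ)) = j / d := fun j => by
    push_cast; field_simp
  rw [e, e]
  have hf : ⌊(k : ℚ) / d⌋ = ((k / d : ℕ) : ℤ) := by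
    exact_mod_cast Rat.floor_natCast_div_natCast k d
  rw [hf, Int.ceil_le, div_le_iff₀ (by exact_mod_cast hd0)]
  have := Nat.lt_div_mul_add (a := k) hd0
  have h2 : k + 1 ≤ (k / d + 1) * d := by linarith
  exact_mod_cast h2

/-- The sum of the series `∑ ⌈n r⌉ / 2 ^ (n + 2)`, which is the number `s^∞` for `0 < r < 1`. -/
noncomputable def ceilSum (r : ℚ) : ℝ := ∑' n : ℕ, (⌈(n : ℚ) * r⌉ : ℝ) / 2 ^ (n + 2)

/-- The number `1/4 + ∑ ⌊n r⌋ / 2 ^ (n + 2)`, which is `st^∞` for `0 < r < 1`. -/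
noncomputable def floorSum (r : ℚ) : ℝ := ∑' n : ℕ, (⌊(n : ℚ) * r⌋ : ℝ) / 2 ^ (n + 2) + 1 / 4

lemma dyadic_ceilWord_eq {r : ℚ} (h0 : 0 < r) (h1 : r < 1) :
    dyadic (ceilWord r) = ceilSum r := by
  rw [dyadic_eq_tsum_ones, ceilWord_zero h0 h1]
  simp [ceilSum, ones_ceilWord h0 h1]

lemma dyadic_floorWord_sub_eq {r : ℚ} (h0 : 0 < r) (h1 : r < 1) :
    dyadic (floorWord r) - 1 / 4 = floorSum r := by
  rw [dyadic_eq_tsum_ones, floorWord_zero h0 h1]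
  simp only [floorSum, ones_floorWord h0 h1, Fin.val_one, Nat.cast_one]
  ring

lemma ceilSum_one : ceilSum 1 = 1 / 2 := by
  simp only [ceilSum, mul_one, Int.ceil_natCast, Int.cast_natCast, tsum_natCast_div_two_pow]

lemma floorSum_one : floorSum 1 = 3 / 4 := by
  simp only [floorSum, mul_one, Int.floor_natCast, Int.cast_natCast, tsum_natCast_div_two_pow]
  norm_num

lemma floorSum_zero : floorSum 0 = 1 / 4 := by
  simp [floorSum]

/-- Along the slopes `k / M`, where `M` is divisible by `1, …, N`, the gap between consecutive
intervals `[s^∞, st^∞]` is at most a tail of the series `∑ (n + 1) / 2 ^ (n + 2)`, since no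
fraction of denominator at most `N` separates these slopes. -/
lemma ceilSum_sub_floorSum_le {N M k : ℕ} (hdvd : ∀ n, 0 < n → n ≤ N → n ∣ M) (hk : k < M) :
    ceilSum ((k + 1 : ℕ) / M) - floorSum (k / M)
      ≤ ∑' n : ℕ, (((n + (N + 1) : ℕ) : ℝ) + 1) / 2 ^ (n + (N + 1) + 2) := by
  have hMpos : 0 < M := by omega
  have hMQ : (0 : ℚ) < M := by exact_mod_cast hMpos
  have hk1 : ((k + 1 : ℕ) : ℚ) / M ≤ 1 := by
    rw [div_le_one hMQ]; exact_mod_cast hk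
  have hk0 : (k : ℚ) / M ≤ 1 := by
    rw [div_le_one hMQ]; exact_mod_cast hk.le
  have hkc := abs_ceil_le (r := (k + 1 : ℕ) / M) (by positivity) hk1
  have s1 := summable_of_abs_le hkc
  have s2 := summable_of_abs_le (abs_floor_le (r := k / M) (by positivity) hk0)
  have s3 : Summable fun n : ℕ => (1 : ℝ) / 2 ^ (n + 2) := by
    have h := summable_of_abs_le (f := fun _ => 1) (fun n => by norm_num)
    simpa using h
  have hLR : ceilSum ((k + 1 : ℕ) / M) - floorSum (k / M)
      = ∑' n : ℕ, ((⌈(n : ℚ) * ((k + 1 : ℕ) / M)⌉ : ℝ) / 2 ^ (n + 2)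
      - (⌊(n : ℚ) * (k / M)⌋ : ℝ) / 2 ^ (n + 2) - 1 / 2 ^ (n + 2)) + 1 / 4 := by
    rw [(s1.sub s2).tsum_sub s3, s1.tsum_sub s2, tsum_one_div_two_pow, ceilSum, floorSum]
    ring
  have sc := (s1.sub s2).sub s3
  generalize hcdef : (fun n : ℕ => (⌈(n : ℚ) * ((k + 1 : ℕ) / M)⌉ : ℝ) / 2 ^ (n + 2)
      - (⌊(n : ℚ) * (k / M)⌋ : ℝ) / 2 ^ (n + 2) - 1 / 2 ^ (n + 2)) = c at hLR sc
  have hcfac : ∀ n, c n = ((⌈(n : ℚ) * ((k + 1 : ℕ) / M)⌉ - ⌊(n : ℚ) * (k / M)⌋ - 1 : ℤ) : ℝ)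
      / 2 ^ (n + 2) := fun n => by
    rw [← hcdef]; push_cast; ring
  have hc0 : c 0 = -1 / 4 := by
    rw [hcfac]; norm_num
  have hhead : ∑ n ∈ range (N + 1), c n ≤ -1 / 4 := by
    rw [sum_range_succ', hc0]
    have : ∑ n ∈ range N, c (n + 1) ≤ 0 := by
      refine sum_nonpos fun n hn => ?_
      have := ceil_le_floor_add_one_of_dvd hMpos
        (hdvd (n + 1) (Nat.succ_pos n) (by have := mem_range.1 hn; omega)) k
      rw [hcfac]
      refine div_nonpos_of_nonpos_of_nonneg ?_ (by positivity)
      exact Int.cast_nonpos.2 (by linarith)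
    linarith
  have htail : ∑' n, c (n + (N + 1))
      ≤ ∑' n : ℕ, (((n + (N + 1) : ℕ) : ℝ) + 1) / 2 ^ (n + (N + 1) + 2) := by
    have s4 : Summable fun n => c (n + (N + 1)) := (summable_nat_add_iff (f := c) (N + 1)).2 sc
    have s5 : Summable fun n : ℕ =>
        (((n + (N + 1) : ℕ) : ℝ) + 1) / 2 ^ (n + (N + 1) + 2) :=
      (summable_nat_add_iff (f := fun n : ℕ => ((n : ℝ) + 1) / 2 ^ (n + 2)) (N + 1)).2
        summable_natCast_div_two_pow
    refine s4.tsum_le_tsum (fun n => ?_) s5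
    rw [hcfac]
    refine div_le_div_of_nonneg_right ?_ (by positivity)
    have h1 := (le_abs_self _).trans (hkc (n + (N + 1)))
    have h2 : 0 ≤ ⌊((n + (N + 1) : ℕ) : ℚ) * (k / M)⌋ := Int.floor_nonneg.2 (by positivity)
    have h3 := (show ⌈((n + (N + 1) : ℕ) : ℚ) * ((k + 1 : ℕ) / M)⌉
      - ⌊((n + (N + 1) : ℕ) : ℚ) * (k / M)⌋ - 1 ≤ ((n + (N + 1) : ℕ) : ℤ) + 1 by linarith)
    have h4 := (Int.cast_le (R := ℝ)).2 h3
    rwa [Int.cast_add, Int.cast_natCast, Int.cast_one] at h4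
  have hsplit : ∑' n, c n = _ := (sc.sum_add_tsum_nat_add (N + 1)).symm
  have hLR' : ceilSum ((k + 1 : ℕ) / M) - floorSum (k / M) = ∑' n, c n + 1 / 4 := by
    rw [hLR, ← hcdef]
  linarith

/-- The intervals `[s^∞, st^∞]` meet every open subinterval of `(1/4, 1/2)`. -/
lemma exists_slope {x y : ℝ} (hx : 1 / 4 ≤ x) (hxy : x < y) (hy : y ≤ 1 / 2) :
    ∃ r : ℚ, 0 < r ∧ r < 1 ∧ dyadic (ceilWord r) < y ∧ x < dyadic (floorWord r) - 1 / 4 := by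
  obtain ⟨N, hN⟩ := (((tendsto_order.1 (tendsto_sum_nat_add
    fun n : ℕ => ((n : ℝ) + 1) / 2 ^ (n + 2))).2 (y - x) (by linarith)).and
    (Filter.eventually_gt_atTop 0)).exists
  obtain ⟨hN, hN0⟩ := hN
  obtain _ | N := N
  · exact absurd hN0 (lt_irrefl 0)
  obtain ⟨M, hMpos, hdvd⟩ : ∃ M : ℕ, 0 < M ∧ ∀ n, 0 < n → n ≤ N → n ∣ M :=
    ⟨N.factorial, N.factorial_pos, fun n h0 hn => Nat.dvd_factorial h0 hn⟩
  have hMQ : (0 : ℚ) < M := by exact_mod_cast hMpos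
  -- the first slope `k / M` whose right endpoint exceeds `x`
  have hexM : x < floorSum ((M : ℕ) / M) := by
    rw [div_self hMQ.ne', floorSum_one]
    linarith
  have hex : ∃ k : ℕ, x < floorSum (k / M) := ⟨M, hexM⟩
  classical
  have hk := Nat.find_spec hex
  have hmin : ∀ j < Nat.find hex, floorSum (j / M) ≤ x :=
    fun j hj => not_lt.1 (Nat.find_min hex hj)
  have hkM : Nat.find hex ≤ M := Nat.find_min' hex hexM
  rcases h : Nat.find hex with _ | k
  · rw [h, Nat.cast_zero, zero_div, floorSum_zero] at hk
    linarith
  rw [h] at hk hmin hkM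
  have hg := ceilSum_sub_floorSum_le (k := k) hdvd (by omega)
  have hRk := hmin k (by omega)
  have hLy : ceilSum ((k + 1 : ℕ) / M) < y := by linarith
  have hkM' : k + 1 < M := by
    refine lt_of_le_of_ne hkM fun e => ?_
    rw [e, div_self hMQ.ne', ceilSum_one] at hLy
    linarith
  have hr0 : (0 : ℚ) < (k + 1 : ℕ) / M := by positivity
  have hr1 : ((k + 1 : ℕ) : ℚ) / M < 1 := by
    rw [div_lt_one hMQ]; exact_mod_cast hkM'
  exact ⟨(k + 1 : ℕ) / M, hr0, hr1, by rwa [dyadic_ceilWord_eq hr0 hr1],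
    by rwa [dyadic_floorWord_sub_eq hr0 hr1]⟩

/-! ### Cyclically balanced words -/

/-- The prefix of length `n` of an infinite word. -/
def prefixWord (x : InfWord) (n : ℕ) : Word := (List.range n).map x

/-- The number of `1`s among the letters `x i, …, x (i + n - 1)`. -/
def factorOnes (x : InfWord) (i n : ℕ) : ℤ := ∑ k ∈ range n, ((x (i + k) : ℕ) : ℤ)

lemma ones_eq_factorOnes (x : InfWord) (n : ℕ) : ones x n = factorOnes x 1 n :=
  sum_congr rfl fun i _ => by rw [add_comm]

@[simp] lemma length_prefixWord (x : InfWord) (n : ℕ) : (prefixWord x n).length = n := by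
  simp [prefixWord]

lemma prefixWord_add (x : InfWord) (m n : ℕ) :
    prefixWord x (m + n) = prefixWord x m ++ prefixWord (shift m x) n := by
  simp [prefixWord, List.range_add, shift, Function.comp_def]

lemma prefixWord_succ (x : InfWord) (n : ℕ) :
    prefixWord x (n + 1) = prefixWord x n ++ [x n] := by
  simp [prefixWord, List.range_succ]

lemma count_prefixWord (x : InfWord) (n : ℕ) :
    ((prefixWord x n).count 1 : ℤ) = ∑ k ∈ range n, ((x k : ℕ) : ℤ) := by
  induction n with
  | zero => simp [prefixWord]
  | succ n ih =>
    rw [prefixWord_succ, List.count_append, sum_range_succ, Nat.cast_add, ih]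
    rcases letter_eq (x n) with h | h <;> simp [h]

lemma count_prefixWord_shift (x : InfWord) (i n : ℕ) :
    ((prefixWord (shift i x) n).count 1 : ℤ) = factorOnes x i n :=
  count_prefixWord _ _

lemma infix_prefixWord {x : InfWord} {u : Word} {N : ℕ} (h : u <:+: prefixWord x N) :
    ∃ i, i + u.length ≤ N ∧ u = prefixWord (shift i x) u.length := by
  obtain ⟨s, t, hst⟩ := h
  have hN : N = s.length + u.length + t.length := by
    have := congrArg List.length hst
    simpa [add_assoc] using this.symm
  refine ⟨s.length, by omega, ?_⟩
  rw [hN, prefixWord_add, prefixWord_add] at hst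
  have h1 := (List.append_inj hst (by simp)).1
  exact (List.append_inj h1 (by simp)).2

lemma prefixWord_shift_infix (x : InfWord) {i n N : ℕ} (h : i + n ≤ N) :
    prefixWord (shift i x) n <:+: prefixWord x N := by
  obtain ⟨m, rfl⟩ := Nat.exists_eq_add_of_le h
  rw [prefixWord_add, prefixWord_add]
  exact ⟨prefixWord x i, _, rfl⟩

lemma isBalanced_prefixWord_iff (x : InfWord) (N : ℕ) : IsBalanced (prefixWord x N) ↔
    ∀ i j n, i + n ≤ N → j + n ≤ N → |factorOnes x i n - factorOnes x j n| ≤ 1 := by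
  constructor
  · intro h i j n hi hj
    have := h _ _ (prefixWord_shift_infix x hi) (prefixWord_shift_infix x hj) (by simp)
    rwa [count_prefixWord_shift, count_prefixWord_shift] at this
  · intro h u v hu hv huv
    obtain ⟨i, hi, hui⟩ := infix_prefixWord hu
    obtain ⟨j, hj, hvj⟩ := infix_prefixWord hv
    rw [hui, hvj, count_prefixWord_shift, count_prefixWord_shift, huv]
    exact h i j _ (huv ▸ hi) hj

lemma prefixWord_append_self {x : InfWord} {q : ℕ} (hx : Function.Periodic x q) :
    prefixWord x q ++ prefixWord x q = prefixWord x (q + q) := by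
  have h : shift q x = x := funext fun i => by rw [shift, add_comm]; exact hx i
  rw [prefixWord_add, h]

lemma wordRep_prefixWord {x : InfWord} {q : ℕ} (hq : 0 < q) (hx : Function.Periodic x q) :
    wordRep (prefixWord x q) = x := by
  funext n
  have hn := Nat.mod_lt n hq
  rw [wordRep, length_prefixWord, List.getD_eq_getElem _ _ (by simpa using hn)]
  simp [prefixWord, hx.map_mod_nat n]

lemma wordRep_periodic (w : Word) : Function.Periodic (wordRep w) w.length := fun n => by
  simp [wordRep]

lemma prefixWord_wordRep (w : Word) : prefixWord (wordRep w) w.length = w := by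
  refine List.ext_getElem (by simp) fun n h1 h2 => ?_
  simp [prefixWord, wordRep, Nat.mod_eq_of_lt h2, h2]

/-- Lexicographic comparison of prefixes at the first differing letter. -/
lemma prefixWord_lt {x y : InfWord} {n q : ℕ} (hn : n < q) (h : ∀ i < n, x i = y i)
    (hlt : x n < y n) : prefixWord x q < prefixWord y q := by
  obtain ⟨m, rfl⟩ := Nat.exists_eq_add_of_lt hn
  have e : prefixWord x n = prefixWord y n :=
    List.map_congr_left fun i hi => h i (List.mem_range.1 hi)
  rw [add_assoc, prefixWord_add, prefixWord_add y, e, add_comm m, prefixWord_add,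
    prefixWord_add (shift n y)]
  refine List.append_left_lt ?_
  simp only [prefixWord, List.range_one, List.map_cons, List.map_nil, List.cons_append]
  exact List.cons_lt_cons_iff.2 (Or.inl hlt)

lemma sum_periodic {x : InfWord} {q : ℕ} (hx : Function.Periodic x q) (k : ℕ) :
    ∑ i ∈ range q, ((x (i + k) : ℕ) : ℤ) = ∑ i ∈ range q, ((x i : ℕ) : ℤ) := by
  induction k with
  | zero => rfl
  | succ k ih =>
    have h1 := sum_range_succ (fun i => ((x (i + k) : ℕ) : ℤ)) q
    have h2 := sum_range_succ' (fun i => ((x (i + k) : ℕ) : ℤ)) q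
    have h3 : x (q + k) = x (0 + k) := by rw [zero_add, add_comm]; exact hx k
    rw [h3] at h1
    rw [← ih]
    simp only [add_assoc, add_comm 1 k] at h1 h2 ⊢
    linarith

lemma sum_factorOnes {x : InfWord} {q : ℕ} (hx : Function.Periodic x q) (n : ℕ) :
    ∑ i ∈ range q, factorOnes x i n = n * ∑ i ∈ range q, ((x i : ℕ) : ℤ) := by
  simp only [factorOnes]
  rw [sum_comm]
  simp [sum_periodic hx]

/-- A factor whose count differs by at most one from those of all cyclic factors of its length
has a count of at most the ceiling of their average `n r`. -/
lemma factorOnes_le {x : InfWord} {q : ℕ} {p : ℤ} {r : ℚ} (hx : Function.Periodic x q)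
    (hr : r * q = p) (hp : ∑ i ∈ range q, ((x i : ℕ) : ℤ) = p) {n j : ℕ} (hj : j < q)
    (hb : ∀ i < q, |factorOnes x i n - factorOnes x j n| ≤ 1) :
    factorOnes x j n ≤ ⌈(n : ℚ) * r⌉ := by
  by_contra! hc
  have h1 : ∑ i ∈ range q, ⌈(n : ℚ) * r⌉ < ∑ i ∈ range q, factorOnes x i n := by
    refine sum_lt_sum (fun i hi => ?_) ⟨j, mem_range.2 hj, hc⟩
    have := (abs_le.1 (hb i (mem_range.1 hi))).1
    omega
  rw [sum_factorOnes hx, hp, sum_const, card_range, nsmul_eq_mul] at h1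
  have h2 : (n : ℚ) * p ≤ q * ⌈(n : ℚ) * r⌉ := by
    rw [← hr]
    have := mul_le_mul_of_nonneg_left (Int.le_ceil ((n : ℚ) * r)) (Nat.cast_nonneg (α := ℚ) q)
    linarith
  have h3 : (n : ℤ) * p ≤ q * ⌈(n : ℚ) * r⌉ := by exact_mod_cast h2
  omega

lemma le_factorOnes {x : InfWord} {q : ℕ} {p : ℤ} {r : ℚ} (hx : Function.Periodic x q)
    (hr : r * q = p) (hp : ∑ i ∈ range q, ((x i : ℕ) : ℤ) = p) {n j : ℕ} (hj : j < q)
    (hb : ∀ i < q, |factorOnes x i n - factorOnes x j n| ≤ 1) :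
    ⌊(n : ℚ) * r⌋ ≤ factorOnes x j n := by
  by_contra! hc
  have h1 : ∑ i ∈ range q, factorOnes x i n < ∑ i ∈ range q, ⌊(n : ℚ) * r⌋ := by
    refine sum_lt_sum (fun i hi => ?_) ⟨j, mem_range.2 hj, hc⟩
    have := (abs_le.1 (hb i (mem_range.1 hi))).2
    omega
  rw [sum_factorOnes hx, hp, sum_const, card_range, nsmul_eq_mul] at h1
  have h2 : q * ⌊(n : ℚ) * r⌋ ≤ (n : ℚ) * p := by
    rw [← hr]
    have := mul_le_mul_of_nonneg_left (Int.floor_le ((n : ℚ) * r)) (Nat.cast_nonneg (α := ℚ) q)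
    linarith
  have h3 : q * ⌊(n : ℚ) * r⌋ ≤ (n : ℤ) * p := by exact_mod_cast h2
  omega

lemma two_le_den {r : ℚ} (h0 : 0 < r) (h1 : r < 1) : 2 ≤ r.den := by
  by_contra! hc
  have hd : r.den = 1 := by have := r.den_pos; omega
  have h := Rat.mul_den_eq_num r
  rw [hd, Nat.cast_one, mul_one] at h
  rw [h] at h0 h1
  have a0 : 0 < r.num := by exact_mod_cast h0
  have a1 : r.num < 1 := by exact_mod_cast h1
  omega

lemma exists_wordRep_of_mem_ratioWords {r : ℚ} {c : Fin 2} {w : Word} (hw : w ∈ ratioWords r c) :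
    ∃ x : InfWord, w = prefixWord x r.den ∧ Function.Periodic x r.den ∧ x 0 = c ∧
      ∑ i ∈ range r.den, ((x i : ℕ) : ℤ) = r.num ∧
      ∀ i j n, i + n ≤ r.den + r.den → j + n ≤ r.den + r.den →
        |factorOnes x i n - factorOnes x j n| ≤ 1 := by
  obtain ⟨hbal, hlen, hratio, hhead⟩ := hw
  have hper := wordRep_periodic w
  have hpre := prefixWord_wordRep w
  rw [hlen] at hper hpre hratio
  have hd : (r.den : ℚ) ≠ 0 := by exact_mod_cast r.den_ne_zero
  refine ⟨wordRep w, hpre.symm, hper, ?_, ?_, ?_⟩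
  · cases w with
    | nil => simp at hhead
    | cons a l => simpa [wordRep] using hhead
  · rw [← count_prefixWord, hpre]
    rw [div_eq_iff hd, Rat.mul_den_eq_num] at hratio
    exact_mod_cast hratio
  · rw [IsCyclicallyBalanced, ← hpre, prefixWord_append_self hper] at hbal
    exact (isBalanced_prefixWord_iff _ _).1 hbal

lemma prefixWord_mem_ratioWords {r : ℚ} {c : Fin 2} {x : InfWord}
    (hx : Function.Periodic x r.den) (hc : x 0 = c)
    (hsum : ∑ i ∈ range r.den, ((x i : ℕ) : ℤ) = r.num)
    (hb : ∀ i j n, |factorOnes x i n - factorOnes x j n| ≤ 1) :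
    prefixWord x r.den ∈ ratioWords r c := by
  have hd : (r.den : ℚ) ≠ 0 := by exact_mod_cast r.den_ne_zero
  refine ⟨?_, length_prefixWord _ _, ?_, ?_⟩
  · rw [IsCyclicallyBalanced, prefixWord_append_self hx]
    exact (isBalanced_prefixWord_iff _ _).2 fun i j n _ _ => hb i j n
  · rw [length_prefixWord, div_eq_iff hd, Rat.mul_den_eq_num]
    rw [← count_prefixWord] at hsum
    exact_mod_cast hsum
  · obtain ⟨m, hm⟩ := Nat.exists_eq_succ_of_ne_zero r.den_ne_zero
    rw [hm, prefixWord, List.range_succ_eq_map]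
    simp [hc]

lemma factorOnes_incrementWord {f : ℤ → ℤ} (hf : ∀ z, f z = f (z - 1) ∨ f z = f (z - 1) + 1)
    (i n : ℕ) : factorOnes (incrementWord f) i n = f (i + n - 1) - f (i - 1) := by
  induction n with
  | zero => simp [factorOnes]
  | succ n ih =>
    rw [factorOnes, sum_range_succ, ← factorOnes, ih, incrementWord_val (hf _)]
    push_cast
    rw [show (i : ℤ) + (n + 1) - 1 = i + n by ring]
    ring

lemma isGreatest_prefixWord_ceilWord {r : ℚ} (h0 : 0 < r) (h1 : r < 1) :
    IsGreatest (ratioWords r 0) (prefixWord (ceilWord r) r.den) := by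
  have hq := two_le_den h0 h1
  have hfac : ∀ i n : ℕ, factorOnes (ceilWord r) i n
      = ⌈((i : ℚ) - 1) * r + n * r⌉ - ⌈((i : ℚ) - 1) * r⌉ := fun i n => by
    rw [ceilWord, factorOnes_incrementWord (ceil_increment h0 h1)]
    push_cast
    rw [show ((i : ℚ) + n - 1) * r = (i - 1) * r + n * r by ring]
  refine ⟨prefixWord_mem_ratioWords (ceilWord_add_den r) (ceilWord_zero h0 h1) ?_ ?_, ?_⟩
  · have h := hfac 0 r.den
    have h' : ⌈-r⌉ = 0 := Int.ceil_eq_zero_iff.2 ⟨by linarith, by linarith⟩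
    rw [mul_comm (r.den : ℚ), Rat.mul_den_eq_num, Int.ceil_add_intCast] at h
    simpa [factorOnes, h'] using h
  · have hbd : ∀ i n : ℕ, ⌈(n : ℚ) * r⌉ - 1 ≤ factorOnes (ceilWord r) i n ∧
        factorOnes (ceilWord r) i n ≤ ⌈(n : ℚ) * r⌉ := fun i n => by
      rw [hfac]
      have := Int.ceil_add_le (((i : ℚ) - 1) * r) (n * r)
      have := Int.ceil_add_ceil_le (((i : ℚ) - 1) * r) (n * r)
      omega
    intro i j n
    have := hbd i n
    have := hbd j n
    rw [abs_le]
    omega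
  · intro w hw
    obtain ⟨x, rfl, hper, hx0, hsum, hb⟩ := exists_wordRep_of_mem_ratioWords hw
    by_cases hall : ∀ i < r.den, x i = ceilWord r i
    · exact (List.map_congr_left fun i hi => hall i (List.mem_range.1 hi)).le
    classical
    push Not at hall
    obtain ⟨hn, hne⟩ := Nat.find_spec hall
    have hmin : ∀ i < Nat.find hall, x i = ceilWord r i := fun i hi => by
      by_contra hc
      exact Nat.find_min hall hi ⟨hi.trans hn, hc⟩
    refine (prefixWord_lt hn hmin ?_).le
    generalize Nat.find hall = n at hn hne hmin
    obtain _ | n := n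
    · exact absurd (hx0.trans (ceilWord_zero h0 h1).symm) hne
    have hle := factorOnes_le (n := n + 1) (j := 1) hper (Rat.mul_den_eq_num r) hsum (by omega)
      fun i hi => hb i 1 (n + 1) (by omega) (by omega)
    have hsame : ones x n = ones (ceilWord r) n :=
      sum_congr rfl fun i hi => by rw [hmin (i + 1) (by have := mem_range.1 hi; omega)]
    rw [← ones_eq_factorOnes, ← ones_ceilWord h0 h1, ones_succ, ones_succ, hsame] at hle
    rcases letter_eq (x (n + 1)) with h | h <;> rcases letter_eq (ceilWord r (n + 1)) with h' | h'
    · exact absurd (h.trans h'.symm) hne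
    · rw [h, h']; decide
    · rw [h, h'] at hle; norm_num at hle
    · exact absurd (h.trans h'.symm) hne

lemma isLeast_prefixWord_floorWord {r : ℚ} (h0 : 0 < r) (h1 : r < 1) :
    IsLeast (ratioWords r 1) (prefixWord (floorWord r) r.den) := by
  have hq := two_le_den h0 h1
  have hfac : ∀ i n : ℕ, factorOnes (floorWord r) i n
      = ⌊((i : ℚ) - 1) * r + n * r⌋ - ⌊((i : ℚ) - 1) * r⌋ := fun i n => by
    rw [floorWord, factorOnes_incrementWord (floor_increment h0 h1)]
    push_cast
    rw [show ((i : ℚ) + n - 1) * r = (i - 1) * r + n * r by ring]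
  refine ⟨prefixWord_mem_ratioWords (floorWord_add_den r) (floorWord_zero h0 h1) ?_ ?_, ?_⟩
  · have h := hfac 0 r.den
    rw [mul_comm (r.den : ℚ), Rat.mul_den_eq_num, Int.floor_add_intCast] at h
    simpa [factorOnes] using h
  · have hbd : ∀ i n : ℕ, ⌊(n : ℚ) * r⌋ ≤ factorOnes (floorWord r) i n ∧
        factorOnes (floorWord r) i n ≤ ⌊(n : ℚ) * r⌋ + 1 := fun i n => by
      rw [hfac]
      have := Int.le_floor_add (((i : ℚ) - 1) * r) (n * r)
      have := Int.le_floor_add_floor (((i : ℚ) - 1) * r) (n * r)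
      omega
    intro i j n
    have := hbd i n
    have := hbd j n
    rw [abs_le]
    omega
  · intro w hw
    obtain ⟨x, rfl, hper, hx0, hsum, hb⟩ := exists_wordRep_of_mem_ratioWords hw
    by_cases hall : ∀ i < r.den, x i = floorWord r i
    · exact (List.map_congr_left fun i hi => hall i (List.mem_range.1 hi)).ge
    classical
    push Not at hall
    obtain ⟨hn, hne⟩ := Nat.find_spec hall
    have hmin : ∀ i < Nat.find hall, x i = floorWord r i := fun i hi => by
      by_contra hc
      exact Nat.find_min hall hi ⟨hi.trans hn, hc⟩
    refine (prefixWord_lt hn (fun i hi => (hmin i hi).symm) ?_).le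
    generalize Nat.find hall = n at hn hne hmin
    obtain _ | n := n
    · exact absurd (hx0.trans (floorWord_zero h0 h1).symm) hne
    have hle := le_factorOnes (n := n + 1) (j := 1) hper (Rat.mul_den_eq_num r) hsum (by omega)
      fun i hi => hb i 1 (n + 1) (by omega) (by omega)
    have hsame : ones x n = ones (floorWord r) n :=
      sum_congr rfl fun i hi => by rw [hmin (i + 1) (by have := mem_range.1 hi; omega)]
    rw [← ones_eq_factorOnes, ← ones_floorWord h0 h1, ones_succ, ones_succ, hsame] at hle
    rcases letter_eq (x (n + 1)) with h | h <;>
      rcases letter_eq (floorWord r (n + 1)) with h' | h'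
    · exact absurd (h.trans h'.symm) hne
    · rw [h, h'] at hle; norm_num at hle
    · rw [h, h']; decide
    · exact absurd (h.trans h'.symm) hne

lemma omegaMinus_eq {r : ℚ} (h0 : 0 < r) (h1 : r < 1) :
    omegaMinus r = prefixWord (ceilWord r) r.den := by
  have h : ∃ w, IsGreatest (ratioWords r 0) w := ⟨_, isGreatest_prefixWord_ceilWord h0 h1⟩
  rw [omegaMinus, dif_pos h]
  exact h.choose_spec.unique (isGreatest_prefixWord_ceilWord h0 h1)

lemma omegaPlus_eq {r : ℚ} (h0 : 0 < r) (h1 : r < 1) :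
    omegaPlus r = prefixWord (floorWord r) r.den := by
  have h : ∃ w, IsLeast (ratioWords r 1) w := ⟨_, isLeast_prefixWord_floorWord h0 h1⟩
  rw [omegaPlus, dif_pos h]
  exact h.choose_spec.unique (isLeast_prefixWord_floorWord h0 h1)

lemma ceil_eq_floor_add_one {r : ℚ} {z : ℕ} (hz : 0 < z) (hzr : z < r.den) :
    ⌈(z : ℚ) * r⌉ = ⌊(z : ℚ) * r⌋ + 1 := by
  rw [Int.ceil_eq_floor_add_one_iff_notMem]
  rintro ⟨m, hm⟩
  have h : (m : ℚ) * r.den = z * r.num := by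
    rw [hm, ← Rat.mul_den_eq_num]; ring
  have h' : m * r.den = z * r.num := by exact_mod_cast h
  have hdvd : (r.den : ℤ) ∣ z * r.num := ⟨m, by rw [← h']; ring⟩
  have hcop : IsCoprime (r.den : ℤ) r.num := r.isCoprime_num_den.symm
  have := Int.le_of_dvd (by exact_mod_cast hz) (hcop.dvd_of_dvd_mul_right hdvd)
  omega

/-- The words `s` and `t` differ exactly in their first two letters `01` and `10`. -/
lemma ceilWord_eq_floorWord {r : ℚ} (h0 : 0 < r) (h1 : r < 1) {n : ℕ} (hn : 2 ≤ n)
    (hnr : n < r.den) : ceilWord r n = floorWord r n := by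
  have hc := ceilWord_val h0 h1 n
  have hf := floorWord_val h0 h1 n
  have e : (n : ℚ) - 1 = ((n - 1 : ℕ) : ℚ) := by
    rw [Nat.cast_sub (by omega)]; norm_num
  rw [e, ceil_eq_floor_add_one (by omega) hnr, ceil_eq_floor_add_one (by omega) (by omega)] at hc
  rw [e] at hf
  apply Fin.val_injective
  omega

lemma repS_eq {r : ℚ} (h0 : 0 < r) (h1 : r < 1) : repS r = dyadic (ceilWord r) := by
  rw [repS, omegaMinus_eq h0 h1, wordRep_prefixWord r.den_pos (ceilWord_add_den r)]

lemma repT_eq {r : ℚ} (h0 : 0 < r) (h1 : r < 1) : repT r = dyadic (floorWord r) := by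
  rw [repT, omegaPlus_eq h0 h1, wordRep_prefixWord r.den_pos (floorWord_add_den r)]

lemma wordAppend_prefixWord {x y : InfWord} {q : ℕ} (hq : 2 ≤ q) (hy : Function.Periodic y q)
    (h0 : x 0 = y 1) (h1 : x 1 = y 0) (h : ∀ n, 2 ≤ n → n < q → x n = y n) :
    wordAppend (prefixWord x q) y = exchange y := by
  funext n
  rw [wordAppend, length_prefixWord]
  split_ifs with hn
  · rw [List.getD_eq_getElem _ _ (by simpa using hn)]
    simp only [prefixWord, List.getElem_map, List.getElem_range]
    obtain _ | _ | n := n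
    · exact h0
    · exact h1
    · exact h _ (by omega) hn
  · rw [exchange, if_neg (by omega), if_neg (by omega)]
    have := hy (n - q)
    rw [Nat.sub_add_cancel (by omega)] at this
    exact this.symm

lemma appST_eq {r : ℚ} (h0 : 0 < r) (h1 : r < 1) : appST r = repT r - 1 / 4 := by
  rw [appST, repT_eq h0 h1, omegaMinus_eq h0 h1, omegaPlus_eq h0 h1,
    wordRep_prefixWord r.den_pos (floorWord_add_den r), ← dyadic_exchange_floorWord h0 h1]
  rw [wordAppend_prefixWord (two_le_den h0 h1) (floorWord_add_den r)]
  · rw [ceilWord_zero h0 h1, floorWord_one h0 h1]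
  · rw [ceilWord_one h0 h1, floorWord_zero h0 h1]
  · exact fun n => ceilWord_eq_floorWord h0 h1

lemma appTS_eq {r : ℚ} (h0 : 0 < r) (h1 : r < 1) : appTS r = repS r + 1 / 4 := by
  rw [appTS, repS_eq h0 h1, omegaMinus_eq h0 h1, omegaPlus_eq h0 h1,
    wordRep_prefixWord r.den_pos (ceilWord_add_den r), ← dyadic_exchange_ceilWord h0 h1]
  rw [wordAppend_prefixWord (two_le_den h0 h1) (ceilWord_add_den r)]
  · rw [ceilWord_one h0 h1, floorWord_zero h0 h1]
  · rw [ceilWord_zero h0 h1, floorWord_one h0 h1]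
  · exact fun n hn hr => (ceilWord_eq_floorWord h0 h1 hn hr).symm

/-! ### First order critical holes -/

/-- Two first order critical holes cannot be strictly nested. -/
lemma IsFOCH.not_nested {a b a' b' : ℝ} (h : IsFOCH a b) (h' : IsFOCH a' b') (ha : a' < a)
    (hb : b < b') : False := by
  obtain ⟨c, hc, hc'⟩ := exists_between ha
  obtain ⟨d, hd, hd'⟩ := exists_between hb
  obtain ⟨h1, h2, h3⟩ := h.isHole
  obtain ⟨h1', h2', h3'⟩ := h'.isHole
  have hole : IsHole c d := ⟨by linarith, by linarith, by linarith⟩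
  exact h'.smaller c d hole hc hd' (h.larger c d hole hc' hd)

lemma quarter_lt_repS {r : ℚ} (hr : r ∈ Set.Ioo (0 : ℚ) 1) : 1 / 4 < repS r := by
  rw [repS_eq hr.1 hr.2]; exact quarter_lt_dyadic_ceilWord hr.1 hr.2

lemma repS_add_le_repT {r : ℚ} (hr : r ∈ Set.Ioo (0 : ℚ) 1) : repS r + 1 / 4 ≤ repT r := by
  rw [repS_eq hr.1 hr.2, repT_eq hr.1 hr.2]; exact dyadic_ceilWord_add_le hr.1 hr.2

lemma repT_lt {r : ℚ} (hr : r ∈ Set.Ioo (0 : ℚ) 1) : repT r < 3 / 4 := by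
  rw [repT_eq hr.1 hr.2]; exact dyadic_floorWord_lt hr.1 hr.2

lemma survivors_eq_of_lt_repS {r : ℚ} (hr : r ∈ Set.Ioo (0 : ℚ) 1) {a b : ℝ} (hab : IsHole a b)
    (ha : a < repS r) (hb : repS r + 1 / 4 < b) : survivors a b = {0, 1} := by
  rw [repS_eq hr.1 hr.2] at ha hb
  exact survivors_eq_of_lt_ceilWord hr.1 hr.2 hab ha hb

lemma survivors_eq_of_repT_lt {r : ℚ} (hr : r ∈ Set.Ioo (0 : ℚ) 1) {a b : ℝ} (hab : IsHole a b)
    (ha : a < repT r - 1 / 4) (hb : repT r < b) : survivors a b = {0, 1} := by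
  rw [repT_eq hr.1 hr.2] at ha hb
  exact survivors_eq_of_floorWord_lt hr.1 hr.2 hab ha hb

lemma survivors_ne_of_rep {r : ℚ} (hr : r ∈ Set.Ioo (0 : ℚ) 1) {a b : ℝ}
    (ha : repS r ≤ a) (hb : b ≤ repT r) : survivors a b ≠ {0, 1} := by
  rw [repS_eq hr.1 hr.2] at ha
  rw [repT_eq hr.1 hr.2] at hb
  exact survivors_ne_of_slope hr.1 hr.2 ha hb

lemma exists_rep {x y : ℝ} (hx : 1 / 4 ≤ x) (hxy : x < y) (hy : y ≤ 1 / 2) :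
    ∃ r ∈ Set.Ioo (0 : ℚ) 1, repS r < y ∧ x < repT r - 1 / 4 := by
  obtain ⟨r, h0, h1, hl, hu⟩ := exists_slope hx hxy hy
  exact ⟨r, ⟨h0, h1⟩, by rwa [repS_eq h0 h1], by rwa [repT_eq h0 h1]⟩

lemma isFOCH_half_right {c : ℝ} (h0 : 0 < c) (h1 : c ≤ 1 / 4) : IsFOCH c (1 / 2) where
  isHole := ⟨h0, by linarith, by norm_num⟩
  larger a b hab ha hb := by
    obtain ⟨r, hr, hS, -⟩ := exists_rep (x := 1 / 4) (y := min (b - 1 / 4) (1 / 2)) le_rfl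
      (lt_min (by linarith) (by norm_num)) (min_le_right _ _)
    have := hS.trans_le (min_le_left _ _)
    have := quarter_lt_repS hr
    exact survivors_eq_of_lt_repS hr hab (by linarith) (by linarith)
  smaller a b hab ha hb :=
    survivors_ne (half_mem_survivors hab.2.2 fun h => lt_asymm hb h.2) (by norm_num) (by norm_num)

lemma isFOCH_half_left {c : ℝ} (h0 : 0 < c) (h1 : c ≤ 1 / 4) : IsFOCH (1 / 2) (1 - c) where
  isHole := ⟨by norm_num, by linarith, by linarith⟩
  larger a b hab ha hb := by
    obtain ⟨r, hr, -, hT⟩ := exists_rep (x := max a (1 / 4)) (y := 1 / 2) (le_max_right _ _)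
      (max_lt ha (by norm_num)) le_rfl
    have := (le_max_left _ _).trans_lt hT
    have := repT_lt hr
    exact survivors_eq_of_repT_lt hr hab (by linarith) (by linarith)
  smaller a b hab ha hb :=
    survivors_ne (half_mem_survivors hab.2.2 fun h => lt_asymm ha h.1) (by norm_num) (by norm_num)

lemma isFOCH_repS {r : ℚ} (hr : r ∈ Set.Ioo (0 : ℚ) 1) {b : ℝ} (h1 : repS r + 1 / 4 ≤ b)
    (h2 : b ≤ repT r) : IsFOCH (repS r) b where
  isHole := ⟨by linarith [quarter_lt_repS hr], by linarith, by linarith [repT_lt hr]⟩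
  larger a b' hab ha hb := survivors_eq_of_lt_repS hr hab ha (by linarith)
  smaller a b' hab ha hb := survivors_ne_of_rep hr ha.le (by linarith)

lemma isFOCH_repT {r : ℚ} (hr : r ∈ Set.Ioo (0 : ℚ) 1) {a : ℝ} (h1 : repS r ≤ a)
    (h2 : a ≤ repT r - 1 / 4) : IsFOCH a (repT r) where
  isHole := ⟨by linarith [quarter_lt_repS hr], by linarith, by linarith [repT_lt hr]⟩
  larger a' b' hab ha hb := survivors_eq_of_repT_lt hr hab (by linarith) hb
  smaller a' b' hab ha hb := survivors_ne_of_rep hr (by linarith) hb.le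

lemma mem_exceptionalSet_iff {a : ℝ} : a ∈ exceptionalSet ↔ (1 / 4 < a ∧ a < 1 / 2) ∧
    ∀ r ∈ Set.Ioo (0 : ℚ) 1, a < repS r ∨ repT r - 1 / 4 < a := by
  unfold exceptionalSet
  rw [Set.mem_sdiff, Set.mem_Ioo, Set.mem_iUnion₂, not_exists]
  refine and_congr_right fun _ => forall_congr' fun r => ?_
  rw [not_exists]
  refine forall_congr' fun hr => ?_
  rw [appST_eq hr.1 hr.2, Set.mem_Icc, not_and_or, not_le, not_le]

/-- By density, a point of the exceptional set is approximated by left endpoints `s^∞` from above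
or by right endpoints `st^∞` from below; at both kinds of endpoints a critical hole has length
`1/4`. -/
lemma isFOCH_of_mem_exceptionalSet {a : ℝ} (h : a ∈ exceptionalSet) :
    IsFOCH a (a + 1 / 4) := by
  obtain ⟨⟨h1, h2⟩, hout⟩ := mem_exceptionalSet_iff.1 h
  have happrox : ∀ ε > 0, ∃ r ∈ Set.Ioo (0 : ℚ) 1,
      (a < repS r ∧ repS r < a + ε) ∨ (a - ε < repT r - 1 / 4 ∧ repT r - 1 / 4 < a) := by
    intro ε hε
    obtain ⟨r, hr, hS, hT⟩ := exists_rep (x := max (a - ε) (1 / 4)) (y := min (a + ε) (1 / 2))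
      (le_max_right _ _) (max_lt (lt_min (by linarith) (by linarith))
        (lt_min (by linarith) (by norm_num))) (min_le_right _ _)
    have := hS.trans_le (min_le_left _ _)
    have := (le_max_left _ _).trans_lt hT
    exact ⟨r, hr, (hout r hr).imp (fun h => ⟨h, by linarith⟩) fun h => ⟨by linarith, h⟩⟩
  refine ⟨⟨by linarith, by linarith, by linarith⟩, fun a' b' hab ha hb => ?_,
    fun a' b' hab ha hb => ?_⟩
  · obtain ⟨r, hr, ⟨hl, hu⟩ | ⟨hl, hu⟩⟩ :=
      happrox (min (a - a') (b' - (a + 1 / 4))) (lt_min (by linarith) (by linarith))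
    · have := min_le_right (a - a') (b' - (a + 1 / 4))
      exact survivors_eq_of_lt_repS hr hab (by linarith) (by linarith)
    · have := min_le_left (a - a') (b' - (a + 1 / 4))
      exact survivors_eq_of_repT_lt hr hab (by linarith) (by linarith)
  · obtain ⟨r, hr, ⟨hl, hu⟩ | ⟨hl, hu⟩⟩ :=
      happrox (min (a' - a) (a + 1 / 4 - b')) (lt_min (by linarith) (by linarith))
    · have := min_le_left (a' - a) (a + 1 / 4 - b')
      exact survivors_ne_of_rep hr (by linarith) (by linarith [repS_add_le_repT hr])
    · have := min_le_right (a' - a) (a + 1 / 4 - b')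
      exact survivors_ne_of_rep hr (by linarith [repS_add_le_repT hr]) (by linarith)

lemma exists_isFOCH {a : ℝ} (h1 : 1 / 4 < a) (h2 : a < 1 / 2) :
    ∃ b, a + 1 / 4 ≤ b ∧ IsFOCH a b := by
  by_cases h : a ∈ exceptionalSet
  · exact ⟨_, le_rfl, isFOCH_of_mem_exceptionalSet h⟩
  · rw [mem_exceptionalSet_iff] at h
    push Not at h
    obtain ⟨r, hr, hS, hT⟩ := h ⟨h1, h2⟩
    exact ⟨repT r, by linarith, isFOCH_repT hr hS hT⟩

/-- The pairs on the list that classifies first order critical holes. -/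
def IsCritical (a b : ℝ) : Prop :=
  (∃ c ∈ Set.Ioc (0 : ℝ) (1 / 4), (a = c ∧ b = 1 / 2) ∨ (a = 1 / 2 ∧ b = 1 - c)) ∨
    (a ∈ exceptionalSet ∧ b = a + 1 / 4) ∨
    (∃ r ∈ Set.Ioo (0 : ℚ) 1, a = repS r ∧ b ∈ Set.Icc (appTS r) (repT r)) ∨
    (∃ r ∈ Set.Ioo (0 : ℚ) 1, a ∈ Set.Ioc (repS r) (appST r) ∧ b = repT r)

lemma IsCritical.isFOCH {a b : ℝ} (h : IsCritical a b) : IsFOCH a b := by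
  rcases h with ⟨c, ⟨h0, h1⟩, ⟨rfl, rfl⟩ | ⟨rfl, rfl⟩⟩ | ⟨h, rfl⟩ | ⟨r, hr, rfl, hb⟩ |
    ⟨r, hr, ha, rfl⟩
  · exact isFOCH_half_right h0 h1
  · exact isFOCH_half_left h0 h1
  · exact isFOCH_of_mem_exceptionalSet h
  · rw [appTS_eq hr.1 hr.2] at hb
    exact isFOCH_repS hr hb.1 hb.2
  · rw [appST_eq hr.1 hr.2] at ha
    exact isFOCH_repT hr ha.1.le ha.2

/-- Over an interval `[s^∞, st^∞]`, a critical hole ending at or below `t^∞` is classified. -/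
lemma IsFOCH.isCritical_of_le_repT {a b : ℝ} (h : IsFOCH a b) {r : ℚ}
    (hr : r ∈ Set.Ioo (0 : ℚ) 1) (hS : repS r ≤ a) (hT : a ≤ repT r - 1 / 4)
    (hab : a + 1 / 4 ≤ b) (hb : b ≤ repT r) : IsCritical a b := by
  rcases hS.eq_or_lt with rfl | hS
  · exact Or.inr (Or.inr (Or.inl ⟨r, hr, rfl, by rwa [appTS_eq hr.1 hr.2], hb⟩))
  · rcases hb.eq_or_lt with rfl | hb
    · exact Or.inr (Or.inr (Or.inr ⟨r, hr, ⟨hS, by rwa [appST_eq hr.1 hr.2]⟩, rfl⟩))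
    · exact (h.not_nested (isFOCH_repT hr le_rfl (by linarith)) hS hb).elim

/-- The classified pairs form a maximal chain for the order in which holes move to the right, so
every other pair is strictly nested with one of them. -/
lemma IsFOCH.isCritical {a b : ℝ} (h : IsFOCH a b) : IsCritical a b := by
  obtain ⟨h0, hab, hb1⟩ := h.isHole
  -- a hole starting in `(1/4, 1/2]` has length at least `1/4`
  have hlow : 1 / 4 < a → a ≤ 1 / 2 → a + 1 / 4 ≤ b := by
    intro h1 h2
    by_contra! hc
    obtain ⟨a', ha1, ha2⟩ := exists_between (max_lt h1 (show b - 1 / 4 < a by linarith))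
    obtain ⟨b', hb', hF⟩ := exists_isFOCH ((le_max_left _ _).trans_lt ha1) (by linarith)
    have := (le_max_right _ _).trans_lt ha1
    exact h.not_nested hF ha2 (by linarith)
  -- if `b` is above `a + 1/4`, some interval `[s^∞, st^∞]` contains `a` and extends to its right
  have hright : 1 / 4 ≤ a → a < 1 / 2 → a + 1 / 4 < b →
      ∃ r ∈ Set.Ioo (0 : ℚ) 1, repS r ≤ a ∧ a < repT r - 1 / 4 := by
    intro h1 h2 h3
    obtain ⟨r, hr, hS, hT⟩ := exists_rep (x := a) (y := min (b - 1 / 4) (1 / 2)) h1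
      (lt_min (by linarith) h2) (min_le_right _ _)
    refine ⟨r, hr, ?_, hT⟩
    by_contra! hc
    have := hS.trans_le (min_le_left _ _)
    exact (isFOCH_repS hr le_rfl (repS_add_le_repT hr)).not_nested h hc (by linarith)
  -- if `a` is not the right end of its interval `[s^∞, st^∞]`, then `t^∞` bounds `b`
  have hle : ∀ r ∈ Set.Ioo (0 : ℚ) 1, repS r ≤ a → a < repT r - 1 / 4 → b ≤ repT r := by
    intro r hr hS hT
    by_contra! hc
    exact (isFOCH_repT hr (by linarith) le_rfl).not_nested h hT hc
  rcases le_or_gt a (1 / 4) with ha | ha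
  · have hb : b = 1 / 2 := by
      rcases lt_trichotomy b (1 / 2) with hb | hb | hb
      · exact (h.not_nested (isFOCH_half_right (c := a / 2) (by linarith) (by linarith))
          (by linarith) hb).elim
      · exact hb
      · rcases ha.eq_or_lt with rfl | ha
        · obtain ⟨r, hr, hS, -⟩ := hright le_rfl (by norm_num) (by linarith)
          linarith [quarter_lt_repS hr]
        · exact ((isFOCH_half_right (c := 1 / 4) (by norm_num) le_rfl).not_nested h ha hb).elim
    exact Or.inl ⟨a, ⟨h0, ha⟩, Or.inl ⟨rfl, hb⟩⟩
  rcases lt_trichotomy a (1 / 2) with ha2 | rfl | ha2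
  · have hlow := hlow ha ha2.le
    rcases hlow.eq_or_lt with hb | hb
    · by_cases hE : a ∈ exceptionalSet
      · exact Or.inr (Or.inl ⟨hE, hb.symm⟩)
      · rw [mem_exceptionalSet_iff] at hE
        push Not at hE
        obtain ⟨r, hr, hS, hT⟩ := hE ⟨ha, ha2⟩
        exact h.isCritical_of_le_repT hr hS hT hlow (by linarith)
    · obtain ⟨r, hr, hS, hT⟩ := hright ha.le ha2 hb
      exact h.isCritical_of_le_repT hr hS hT.le hlow (hle r hr hS hT)
  · have := hlow ha le_rfl
    exact Or.inl ⟨1 - b, ⟨by linarith, by linarith⟩, Or.inr ⟨rfl, by ring⟩⟩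
  · have hF := isFOCH_half_left (c := min (1 / 4) ((1 - b) / 2))
      (lt_min (by norm_num) (by linarith)) (min_le_left _ _)
    have := min_le_right (1 / 4) ((1 - b) / 2)
    exact (h.not_nested hF ha2 (by linarith)).elim

lemma IsCritical.sub_mem_Ico {a b : ℝ} (h : IsCritical a b) :
    b - a ∈ Set.Ico (1 / 4 : ℝ) (1 / 2) := by
  rcases h with ⟨c, ⟨h0, h1⟩, ⟨rfl, rfl⟩ | ⟨rfl, rfl⟩⟩ | ⟨h, rfl⟩ | ⟨r, hr, rfl, hb⟩ |
    ⟨r, hr, ha, rfl⟩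
  · constructor <;> linarith
  · constructor <;> linarith
  · constructor <;> linarith
  · rw [appTS_eq hr.1 hr.2] at hb
    constructor <;> linarith [hb.1, hb.2, quarter_lt_repS hr, repT_lt hr]
  · rw [appST_eq hr.1 hr.2] at ha
    constructor <;> linarith [ha.1, ha.2, quarter_lt_repS hr, repT_lt hr]

end DoublingHoles

theorem mainTheorem6 :
    (∀ a b : ℝ, DoublingHoles.IsFOCH a b ↔
      ((∃ c ∈ Set.Ioc (0 : ℝ) (1 / 4), (a = c ∧ b = 1 / 2) ∨ (a = 1 / 2 ∧ b = 1 - c)) ∨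
        (a ∈ DoublingHoles.exceptionalSet ∧ b = a + 1 / 4) ∨
        (∃ r ∈ Set.Ioo (0 : ℚ) 1, a = DoublingHoles.repS r ∧
          b ∈ Set.Icc (DoublingHoles.appTS r) (DoublingHoles.repT r)) ∨
        (∃ r ∈ Set.Ioo (0 : ℚ) 1,
          a ∈ Set.Ioc (DoublingHoles.repS r) (DoublingHoles.appST r) ∧
          b = DoublingHoles.repT r))) ∧
      {l : ℝ | ∃ a b : ℝ, DoublingHoles.IsFOCH a b ∧ l = b - a} = Set.Ico (1 / 4) (1 / 2) := by
  refine ⟨fun a b => ⟨fun h => h.isCritical, fun h => DoublingHoles.IsCritical.isFOCH h⟩, ?_⟩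
  ext l
  constructor
  · rintro ⟨a, b, h, rfl⟩
    exact h.isCritical.sub_mem_Ico
  · rintro ⟨h1, h2⟩
    exact ⟨1 / 2 - l, 1 / 2,
      DoublingHoles.isFOCH_half_right (by linarith) (by linarith), by ring⟩
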